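/- Let $0<q<1$ and let $\nu>-1$ be real with $\nu\notin\{0,1,2,\dots\}$. Write $(a;p)_n=\prod_{k=0}^{n-1}(1-ap^k)$, $(a;p)_\infty=\prod_{k\ge 0}(1-ap^k)$, $$j_\alpha(x,q^2)=\sum_{n\ge 0}(-1)^n\frac{q^{n(n+1)}}{(q^2;q^2)_n(q^{2\alpha+2};q^2)_n}x^{2n},\qquad I_\alpha(x,q^2)=j_\alpha(ix,q^2)\quad(\alpha=\pm\nu),$$ and let the polynomials $P_n$ ($q^{-1}$-Lommel polynomials) be given by $P_{-1}=0$, $P_0=1$ and $$q^{2n+\nu+1}P_{n+1}(x)-q^{2n}(1+q^{2\nu})P_n(x)+q^{2n+\nu-1}P_{n-1}(x)=x\,P_n(x),\qquad n\ge 0.$$ There is exactly one positive Borel measure $\mu$ on $\mathbb R$ with respect to which $(P_n)_{n\ge0}$ is orthonormal. Let $z\in\mathbb C\setminus\operatorname{supp}\mu$ and let $\sqrt z$ be either square root of $z$. Then $t\mapsto 1/(z-t)$ is $\mu$-integrable, the number $$D_\nu(\sqrt z)=q^{-2\nu}I_{-\nu}(q^{1-\nu}\sqrt z,q^2)(-z^{-1};q^2)_\infty(-q^2z;q^2)_\infty-\sigma_\nu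 I_\nu(q\sqrt z,q^2)(-q^{2\nu}z^{-1};q^2)_\infty(-q^{2-2\nu}z;q^2)_\infty,\qquad \sigma_\nu=\frac{(q^{2\nu+2};q^2)_\infty}{(q^{2-2\nu};q^2)_\infty},$$ is nonzero, and $$\int_{\mathbb R}\frac{d\mu(t)}{z-t}=\frac{1}{q^{2\nu}I_\nu(q\sqrt z,q^2)}\left[I_\nu(\sqrt z,q^2)-\frac{(q^{-2\nu}-1)(-z^{-1};q^2)_\infty(-q^2z;q^2)_\infty}{D_\nu(\sqrt z)}\right]$$ whenever $I_\nu(q\sqrt z,q^2)\ne0$. At the points $z\notin\operatorname{supp}\mu$ where $I_\nu(q\sqrt z,q^2)=0$ the right-hand side, as a function of $\sqrt z$, has a removable singularity, and the formula holds with its limit there. -/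

import Mathlib

open MeasureTheory Filter Topology

/-- The finite `q`-shifted factorial `(a;p)_n = ∏_{k<n} (1 - a p^k)`. -/
noncomputable def qPoch (a p : ℂ) (n : ℕ) : ℂ :=
  ∏ k ∈ Finset.range n, (1 - a * p ^ k)

/-- The infinite `q`-shifted factorial `(a;p)_∞ = ∏_{k≥0} (1 - a p^k)`
(used for `|p| < 1`, where the product converges absolutely). -/
noncomputable def qPochInf (a p : ℂ) : ℂ :=
  ∏' k : ℕ, (1 - a * p ^ k)

/-- The normalized third Jackson (Hahn-Exton) `q`-Bessel function with base `p`: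
`j_ν(x;p) = ∑_{n≥0} (-1)^n p^{n(n+1)/2} / ((p;p)_n (p^{ν+1};p)_n) x^{2n}`. -/
noncomputable def qBesselJ (ν p : ℝ) (x : ℂ) : ℂ :=
  ∑' n : ℕ, (-1) ^ n * (p : ℂ) ^ (n * (n + 1) / 2) /
    (qPoch (p : ℂ) (p : ℂ) n * qPoch ((p ^ (ν + 1) : ℝ) : ℂ) (p : ℂ) n) * x ^ (2 * n)

/-- The modified `q`-Bessel function `I_ν(x;p) = j_ν(ix;p)`. -/
noncomputable def qBesselI (ν p : ℝ) (x : ℂ) : ℂ :=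
  qBesselJ ν p (Complex.I * x)

/-- Off-diagonal recurrence coefficient `a_n = q^{2n+ν+1}`. -/
noncomputable def lommelA (q ν : ℝ) (n : ℕ) : ℝ :=
  q ^ (2 * (n : ℝ) + ν + 1)

/-- Diagonal recurrence coefficient `b_n = -q^{2n}(1+q^{2ν})`. -/
noncomputable def lommelB (q ν : ℝ) (n : ℕ) : ℝ :=
  -(q ^ (2 * n) * (1 + q ^ (2 * ν)))

/-- The `q⁻¹`-Lommel polynomials: `P_{-1} = 0`, `P_0 = 1` and
`a_n P_{n+1} + b_n P_n + a_{n-1} P_{n-1} = X P_n`. -/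
noncomputable def lommelP (q ν : ℝ) : ℕ → Polynomial ℝ
  | 0 => 1
  | 1 => Polynomial.C (lommelA q ν 0)⁻¹ * (Polynomial.X - Polynomial.C (lommelB q ν 0))
  | n + 2 => Polynomial.C (lommelA q ν (n + 1))⁻¹ *
      ((Polynomial.X - Polynomial.C (lommelB q ν (n + 1))) * lommelP q ν (n + 1)
        - Polynomial.C (lommelA q ν n) * lommelP q ν n)

/-- The three-term recurrence in evaluated form, for `n = 0` (with `P_{-1} = 0`). -/
theorem lommelP_rec_zero {q : ℝ} (hq : 0 < q) (ν x : ℝ) :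
    q ^ (ν + 1) * (lommelP q ν 1).eval x - (1 + q ^ (2 * ν)) * (lommelP q ν 0).eval x
      = x * (lommelP q ν 0).eval x := by
  have h : q ^ (ν + 1) ≠ 0 := (Real.rpow_pos_of_pos hq _).ne'
  simp [lommelP, lommelA, lommelB]
  field_simp
  ring

/-- The three-term recurrence in evaluated form, at the index `n + 1`. -/
theorem lommelP_rec_succ {q : ℝ} (hq : 0 < q) (ν x : ℝ) (n : ℕ) :
    q ^ (2 * ((n : ℝ) + 1) + ν + 1) * (lommelP q ν (n + 2)).eval x
      - q ^ (2 * (n + 1)) * (1 + q ^ (2 * ν)) * (lommelP q ν (n + 1)).eval x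
      + q ^ (2 * ((n : ℝ) + 1) + ν - 1) * (lommelP q ν n).eval x
      = x * (lommelP q ν (n + 1)).eval x := by
  have h : q ^ (2 * ((n : ℝ) + 1) + ν + 1) ≠ 0 := (Real.rpow_pos_of_pos hq _).ne'
  have e : 2 * ((n : ℝ) + 1) + ν - 1 = 2 * (n : ℝ) + ν + 1 := by ring
  rw [e]
  simp only [lommelP, lommelA, lommelB, Polynomial.eval_mul, Polynomial.eval_sub,
    Polynomial.eval_C, Polynomial.eval_X, Nat.cast_add, Nat.cast_one]
  field_simp
  ring

/-- `μ` is an orthogonality measure of `(P_n)`: a positive Borel measure on `ℝ` for which all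
products `P_n P_m` are integrable and `(P_n)` is orthonormal. -/
structure IsLommelOrthogonalityMeasure (q ν : ℝ) (μ : Measure ℝ) : Prop where
  integrable : ∀ n m : ℕ,
    Integrable (fun t : ℝ => (lommelP q ν n).eval t * (lommelP q ν m).eval t) μ
  orthonormal : ∀ n m : ℕ,
    ∫ t, (lommelP q ν n).eval t * (lommelP q ν m).eval t ∂μ = if n = m then 1 else 0

/-- `σ_ν = (q^{2ν+2};q²)_∞ / (q^{-2ν+2};q²)_∞`. -/
noncomputable def lommelSigma (q ν : ℝ) : ℂ :=
  qPochInf ((q ^ (2 * ν + 2) : ℝ) : ℂ) ((q : ℂ) ^ 2) /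
    qPochInf ((q ^ (-2 * ν + 2) : ℝ) : ℂ) ((q : ℂ) ^ 2)

/-- `(-z⁻¹;q²)_∞ (-q² z;q²)_∞`. -/
noncomputable def lommelTheta (q : ℝ) (z : ℂ) : ℂ :=
  qPochInf (-z⁻¹) ((q : ℂ) ^ 2) * qPochInf (-((q : ℂ) ^ 2 * z)) ((q : ℂ) ^ 2)

/-- The inner denominator, for a square root `s` of `z`:
`q^{-2ν} I_{-ν}(q^{1-ν}s;q²) (-z⁻¹;q²)_∞ (-q²z;q²)_∞
  - σ_ν I_ν(qs;q²) (-q^{2ν}z⁻¹;q²)_∞ (-q^{2-2ν}z;q²)_∞`. -/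
noncomputable def lommelDenom (q ν : ℝ) (z s : ℂ) : ℂ :=
  ((q ^ (-2 * ν) : ℝ) : ℂ) * qBesselI (-ν) (q ^ 2) (((q ^ (1 - ν) : ℝ) : ℂ) * s) * lommelTheta q z
    - lommelSigma q ν * qBesselI ν (q ^ 2) ((q : ℂ) * s) *
      (qPochInf (-(((q ^ (2 * ν) : ℝ) : ℂ) * z⁻¹)) ((q : ℂ) ^ 2) *
        qPochInf (-(((q ^ (2 - 2 * ν) : ℝ) : ℂ) * z)) ((q : ℂ) ^ 2))

/-- The closed form of the Stieltjes transform, for a square root `s` of `z`. -/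
noncomputable def lommelStieltjes (q ν : ℝ) (z s : ℂ) : ℂ :=
  1 / (((q ^ (2 * ν) : ℝ) : ℂ) * qBesselI ν (q ^ 2) ((q : ℂ) * s)) *
    (qBesselI ν (q ^ 2) s
      - (((q ^ (-2 * ν) : ℝ) : ℂ) - 1) * lommelTheta q z / lommelDenom q ν z s)

/-!
The recurrence is that of a Jacobi matrix with summable coefficients, i.e. of a bounded
self-adjoint operator: its spectral measure at the first basis vector is the orthogonality
measure, which is compactly supported and hence determined by its moments.

The functions of the second kind `∫ P_n(t) / (z - t) dμ(t)` are bounded in `n` and solve the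
recurrence, with an inhomogeneity at `n = 0` that amounts to a prescribed value at `n = -1`. The
`q`-Bessel functions `I_ν(q^{-n} √z; q²)` and their `-ν` companions provide two further solutions,
up to a common normalization. By the Jacobi triple product both grow like `z^n q^{-n(n-1)}`, with
theta functions of `z` as leading coefficients, and `D_ν` is the value at `n = -1` of the
combination in which these cancel. Dividing the Plücker relation of the three solutions by this
growth shows that the functions of the second kind are proportional to that combination, which
gives the Stieltjes transform as a ratio of two of its consecutive values.
-/
section SpectralMeasure

variable {H : Type*} [NormedAddCommGroup H] [InnerProductSpace ℂ H] [CompleteSpace H]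

/-- The positive functional `f ↦ ⟪x, f(T) x⟫` on the continuous functions on the (compact) spectrum
of a bounded self-adjoint operator `T`. -/
noncomputable def spectralFunctional (T : H →L[ℂ] H) (hT : IsSelfAdjoint T) (x : H) :
    CompactlySupportedContinuousMap (spectrum ℝ T) ℝ →ₚ[ℝ] ℝ where
  toFun f := RCLike.re (inner ℂ x (cfcHom hT (f : C(spectrum ℝ T, ℝ)) x))
  map_add' f g := by
    have hadd : ((f + g : CompactlySupportedContinuousMap (spectrum ℝ T) ℝ) :
        C(spectrum ℝ T, ℝ)) = f + g := rfl
    simp [hadd]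
  map_smul' r f := by
    have hsmul : ((r • f : CompactlySupportedContinuousMap (spectrum ℝ T) ℝ) :
        C(spectrum ℝ T, ℝ)) = r • (f : C(spectrum ℝ T, ℝ)) := rfl
    simp [hsmul, inner_smul_right_eq_smul]
  monotone' f g hfg := by
    have hpos := ((ContinuousLinearMap.le_def _ _).1
      (cfcHom_mono hT (show (f : C(spectrum ℝ T, ℝ)) ≤ g from hfg))).re_inner_nonneg_right x
    simpa [inner_sub_right] using hpos

/-- The spectral measure of the bounded self-adjoint operator `T` at the vector `x`, as a measure on
`ℝ`: the representing measure of `f ↦ ⟪x, f(T) x⟫`. -/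
noncomputable def spectralMeasure (T : H →L[ℂ] H) (hT : IsSelfAdjoint T) (x : H) : Measure ℝ :=
  (RealRMK.rieszMeasure (spectralFunctional T hT x)).map Subtype.val

variable {T : H →L[ℂ] H} (hT : IsSelfAdjoint T) (x : H)

instance isFiniteMeasure_spectralMeasure : IsFiniteMeasure (spectralMeasure T hT x) := by
  have : CompactSpace (spectrum ℝ T) := isCompact_iff_compactSpace.1
    (ContinuousFunctionalCalculus.isCompact_spectrum (R := ℝ) T)
  unfold spectralMeasure
  infer_instance

theorem ae_mem_spectrum_spectralMeasure : ∀ᵐ t ∂spectralMeasure T hT x, t ∈ spectrum ℝ T := by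
  have hmeas : MeasurableSet (spectrum ℝ T) :=
    (ContinuousFunctionalCalculus.isCompact_spectrum (R := ℝ) T).measurableSet
  exact (ae_map_iff measurable_subtype_coe.aemeasurable hmeas).2
    (Eventually.of_forall Subtype.property)

theorem integral_spectralMeasure {f : ℝ → ℝ} (hf : ContinuousOn f (spectrum ℝ T)) :
    ∫ t, f t ∂spectralMeasure T hT x = RCLike.re (inner ℂ x (cfc f T x)) := by
  have hcompact := ContinuousFunctionalCalculus.isCompact_spectrum (R := ℝ) T
  have : CompactSpace (spectrum ℝ T) := isCompact_iff_compactSpace.1 hcompact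
  rw [spectralMeasure, (MeasurableEmbedding.subtype_coe hcompact.measurableSet).integral_map,
    cfc_apply f T hT hf]
  exact RealRMK.integral_rieszMeasure (spectralFunctional T hT x)
    (CompactlySupportedContinuousMap.continuousMapEquiv ⟨_, hf.domRestrict⟩)

theorem integral_polynomial_spectralMeasure (P : Polynomial ℝ) :
    ∫ t, P.eval t ∂spectralMeasure T hT x =
      RCLike.re (inner ℂ x (Polynomial.aeval T P x)) := by
  rw [integral_spectralMeasure hT x P.continuous.continuousOn, cfc_polynomial P T hT]

theorem exists_ae_abs_le_spectralMeasure : ∃ R : ℝ, ∀ᵐ t ∂spectralMeasure T hT x, |t| ≤ R := by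
  obtain ⟨R, hR⟩ := (ContinuousFunctionalCalculus.isCompact_spectrum (R := ℝ) T).isBounded
    |>.exists_norm_le
  exact ⟨R, (ae_mem_spectrum_spectralMeasure hT x).mono hR⟩

end SpectralMeasure

section JacobiOperator

open InnerProductSpace (rankOne norm_rankOne)

variable {H : Type*} [NormedAddCommGroup H] [InnerProductSpace ℂ H]

/-- The `n`-th summand of the Jacobi operator: it carries the matrix entries `b n` at `(n, n)` and
`a n` at `(n, n + 1)` and `(n + 1, n)`. -/
noncomputable def jacobiSummand (e : ℕ → H) (a b : ℕ → ℝ) (n : ℕ) : H →L[ℂ] H :=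
  b n • rankOne ℂ (e n) (e n) +
    a n • (rankOne ℂ (e (n + 1)) (e n) + rankOne ℂ (e n) (e (n + 1)))

/-- The operator with the Jacobi matrix with diagonal `b` and off-diagonal `a` in the orthonormal
sequence `e`; it is meaningful for summable `a` and `b`, where the series converges in norm. -/
noncomputable def jacobiOperator (e : ℕ → H) (a b : ℕ → ℝ) : H →L[ℂ] H :=
  ∑' n, jacobiSummand e a b n

variable {e : ℕ → H} {a b : ℕ → ℝ}

theorem summable_jacobiSummand [CompleteSpace H] (he : Orthonormal ℂ e)
    (ha : Summable fun n => |a n|) (hb : Summable fun n => |b n|) :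
    Summable (jacobiSummand e a b) := by
  refine .of_norm_bounded (hb.add (ha.mul_right 2)) fun n => (norm_add_le _ _).trans ?_
  have hoff : ‖rankOne ℂ (e (n + 1)) (e n) + rankOne ℂ (e n) (e (n + 1))‖ ≤ 2 :=
    (norm_add_le_of_le (r₁ := 1) (r₂ := 1) (by simp [norm_rankOne, he.1])
      (by simp [norm_rankOne, he.1])).trans_eq one_add_one_eq_two
  rw [norm_smul, norm_smul, Real.norm_eq_abs, Real.norm_eq_abs]
  gcongr
  simp [norm_rankOne, he.1]

theorem isSelfAdjoint_jacobiOperator [CompleteSpace H] (e : ℕ → H) (a b : ℕ → ℝ) :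
    IsSelfAdjoint (jacobiOperator e a b) := by
  rw [jacobiOperator, IsSelfAdjoint, tsum_star]
  refine tsum_congr fun n => ?_
  simp [jacobiSummand, ContinuousLinearMap.star_eq_adjoint, add_comm]

theorem jacobiOperator_apply (h : Summable (jacobiSummand e a b)) (x : H) :
    jacobiOperator e a b x = ∑' n, jacobiSummand e a b n x :=
  ((ContinuousLinearMap.apply ℂ H x).hasSum h.hasSum).tsum_eq.symm

theorem jacobiSummand_apply_of_ne (he : Orthonormal ℂ e) {n k : ℕ} (hk : n ≠ k)
    (hk' : n + 1 ≠ k) : jacobiSummand e a b n (e k) = 0 := by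
  simp [jacobiSummand, orthonormal_iff_ite.1 he, hk, hk']

theorem jacobiOperator_apply_zero (he : Orthonormal ℂ e) (h : Summable (jacobiSummand e a b)) :
    jacobiOperator e a b (e 0) = b 0 • e 0 + a 0 • e 1 := by
  rw [jacobiOperator_apply h, tsum_eq_single 0 fun n hn =>
    jacobiSummand_apply_of_ne he hn n.succ_ne_zero]
  simp [jacobiSummand, orthonormal_iff_ite.1 he, he.1]

theorem jacobiOperator_apply_succ (he : Orthonormal ℂ e) (h : Summable (jacobiSummand e a b))
    (n : ℕ) : jacobiOperator e a b (e (n + 1)) =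
      a n • e n + b (n + 1) • e (n + 1) + a (n + 1) • e (n + 2) := by
  rw [jacobiOperator_apply h, tsum_eq_sum (s := {n, n + 1}), Finset.sum_pair n.succ_ne_self.symm]
  · simp [jacobiSummand, orthonormal_iff_ite.1 he, he.1, add_assoc]
  · intro m hm
    simp only [Finset.mem_insert, Finset.mem_singleton, not_or] at hm
    exact jacobiSummand_apply_of_ne he hm.2 (by simpa using hm.1)

end JacobiOperator

section Determinacy

variable {μ : Measure ℝ}

theorem integrable_of_continuous_of_ae_abs_le [IsFiniteMeasure μ] {R : ℝ}
    (hR : ∀ᵐ t ∂μ, |t| ≤ R) {f : ℝ → ℝ} (hf : Continuous f) : Integrable f μ := by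
  obtain ⟨C, hC⟩ := (isCompact_Icc (a := -R) (b := R)).exists_bound_of_continuousOn
    hf.continuousOn
  exact .of_bound hf.aestronglyMeasurable C (hR.mono fun t ht => hC t (abs_le.1 ht))

theorem ae_abs_lt_of_even_moments_le [IsFiniteMeasure μ] {R S C : ℝ} (hR : 0 ≤ R) (hRS : R < S)
    (hint : ∀ k : ℕ, Integrable (fun t : ℝ => t ^ (2 * k)) μ)
    (hle : ∀ k : ℕ, ∫ t, t ^ (2 * k) ∂μ ≤ C * R ^ (2 * k)) : ∀ᵐ t ∂μ, |t| < S := by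
  have hS : 0 < S := hR.trans_lt hRS
  have hsub : ∀ k : ℕ, {t : ℝ | S ≤ |t|} ⊆ {t | S ^ (2 * k) ≤ t ^ (2 * k)} := fun k t ht => by
    rw [Set.mem_ofPred_eq, ← (even_two_mul k).pow_abs t]
    exact pow_le_pow_left₀ hS.le ht _
  have hmarkov : ∀ k : ℕ, μ.real {t : ℝ | S ≤ |t|} ≤ C * ((R / S) ^ 2) ^ k := fun k => by
    rw [← pow_mul, div_pow, ← mul_div_assoc, le_div_iff₀ (by positivity), mul_comm]
    calc S ^ (2 * k) * μ.real {t : ℝ | S ≤ |t|}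
        ≤ S ^ (2 * k) * μ.real {t | S ^ (2 * k) ≤ t ^ (2 * k)} :=
          mul_le_mul_of_nonneg_left (measureReal_mono (hsub k)) (by positivity)
      _ ≤ ∫ t, t ^ (2 * k) ∂μ := mul_meas_ge_le_integral_of_nonneg
          (.of_forall fun t => (even_two_mul k).pow_nonneg t) (hint k) _
      _ ≤ C * R ^ (2 * k) := hle k
  have hlim : Tendsto (fun k : ℕ => C * ((R / S) ^ 2) ^ k) atTop (𝓝 (C * 0)) :=
    (tendsto_pow_atTop_nhds_zero_of_lt_one (sq_nonneg _)
      (pow_lt_one₀ (by positivity) ((div_lt_one hS).2 hRS) two_ne_zero)).const_mul C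
  have hzero : μ.real {t : ℝ | S ≤ |t|} = 0 :=
    le_antisymm (by simpa using ge_of_tendsto' hlim hmarkov) measureReal_nonneg
  simpa [ae_iff] using (measureReal_eq_zero_iff (measure_ne_top μ _)).1 hzero

theorem abs_integral_sub_integral_le [IsFiniteMeasure μ] {R ε : ℝ} (hR : ∀ᵐ t ∂μ, |t| ≤ R)
    {f g : ℝ → ℝ} (hf : Continuous f) (hg : Continuous g)
    (hfg : ∀ t ∈ Set.Icc (-R) R, |f t - g t| ≤ ε) :
    |∫ t, f t ∂μ - ∫ t, g t ∂μ| ≤ ε * μ.real Set.univ := by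
  rw [← integral_sub (integrable_of_continuous_of_ae_abs_le hR hf)
    (integrable_of_continuous_of_ae_abs_le hR hg), ← Real.norm_eq_abs]
  exact norm_integral_le_of_norm_le_const (hR.mono fun t ht => hfg t (abs_le.1 ht))

theorem measure_eq_of_ae_abs_le_of_integral_polynomial_eq {μ' : Measure ℝ} [IsFiniteMeasure μ]
    [IsFiniteMeasure μ'] {R : ℝ} (hR : ∀ᵐ t ∂μ, |t| ≤ R) (hR' : ∀ᵐ t ∂μ', |t| ≤ R)
    (heq : ∀ P : Polynomial ℝ, ∫ t, P.eval t ∂μ = ∫ t, P.eval t ∂μ') : μ = μ' := by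
  refine ext_of_forall_integral_eq_of_IsFiniteMeasure fun f => eq_of_forall_dist_le fun ε hε => ?_
  set M := μ.real Set.univ + μ'.real Set.univ + 1
  have hMpos : 0 < M := by positivity
  obtain ⟨P, hP⟩ := exists_polynomial_near_of_continuousOn (-R) R f f.continuous.continuousOn
    (ε / M) (by positivity)
  have hclose : ∀ t ∈ Set.Icc (-R) R, |P.eval t - f t| ≤ ε / M := fun t ht => (hP t ht).le
  calc dist (∫ t, f t ∂μ) (∫ t, f t ∂μ')
      ≤ dist (∫ t, f t ∂μ) (∫ t, P.eval t ∂μ) + dist (∫ t, P.eval t ∂μ) (∫ t, f t ∂μ') :=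
        dist_triangle _ _ _
    _ ≤ ε / M * μ.real Set.univ + ε / M * μ'.real Set.univ := by
        refine add_le_add ?_ ?_
        · rw [dist_comm]
          exact abs_integral_sub_integral_le hR P.continuous f.continuous hclose
        · rw [heq P]
          exact abs_integral_sub_integral_le hR' P.continuous f.continuous hclose
    _ ≤ ε / M * M := by rw [← mul_add]; gcongr; exact le_add_of_nonneg_right zero_le_one
    _ = ε := div_mul_cancel₀ ε hMpos.ne'

theorem measure_eq_of_integral_polynomial_eq {μ' : Measure ℝ} [IsFiniteMeasure μ]
    [IsFiniteMeasure μ'] {R : ℝ} (hR : ∀ᵐ t ∂μ, |t| ≤ R)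
    (hint : ∀ P : Polynomial ℝ, Integrable (fun t => P.eval t) μ')
    (heq : ∀ P : Polynomial ℝ, ∫ t, P.eval t ∂μ = ∫ t, P.eval t ∂μ') : μ = μ' := by
  have hmoments : ∀ k : ℕ, ∫ t, t ^ (2 * k) ∂μ' ≤ μ.real Set.univ * |R| ^ (2 * k) := fun k => by
    have hX := heq (Polynomial.X ^ (2 * k))
    simp only [Polynomial.eval_pow, Polynomial.eval_X] at hX
    rw [← hX]
    refine le_of_le_of_eq ?_ (integral_const (|R| ^ (2 * k)))
    refine integral_mono_ae (integrable_of_continuous_of_ae_abs_le hR (by fun_prop))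
      (integrable_const _) (hR.mono fun t ht => ?_)
    simp only [← (even_two_mul k).pow_abs t]
    exact pow_le_pow_left₀ (abs_nonneg t) (ht.trans (le_abs_self R)) _
  have hR' := ae_abs_lt_of_even_moments_le (abs_nonneg R) (lt_add_one |R|)
    (fun k => by simpa using hint (Polynomial.X ^ (2 * k))) hmoments
  exact measure_eq_of_ae_abs_le_of_integral_polynomial_eq
    (hR.mono fun t ht => ht.trans ((le_abs_self R).trans (le_add_of_nonneg_right zero_le_one)))
    (hR'.mono fun t ht => ht.le) heq

end Determinacy

section JacobiSystem

open Polynomial (X aeval)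

/-- The polynomials `P n` satisfy the three-term recurrence with Jacobi coefficients `a n` (off the
diagonal) and `b n` (on it), starting from `P (-1) = 0` and `P 0 = 1`. -/
structure IsJacobiSystem (a b : ℕ → ℝ) (P : ℕ → Polynomial ℝ) : Prop where
  ne_zero : ∀ n, a n ≠ 0
  zero : P 0 = 1
  X_mul_zero : X * P 0 = b 0 • P 0 + a 0 • P 1
  X_mul_succ : ∀ n, X * P (n + 1) = a n • P n + b (n + 1) • P (n + 1) + a (n + 1) • P (n + 2)

/-- The polynomials `P n` are orthonormal in `L²(μ)`; this is `IsLommelOrthogonalityMeasure` for an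
arbitrary sequence of polynomials. -/
structure IsOrthonormalMeasure (P : ℕ → Polynomial ℝ) (μ : Measure ℝ) : Prop where
  integrable : ∀ n m, Integrable (fun t => (P n).eval t * (P m).eval t) μ
  orthonormal : ∀ n m, ∫ t, (P n).eval t * (P m).eval t ∂μ = if n = m then 1 else 0

variable {a b : ℕ → ℝ} {P : ℕ → Polynomial ℝ} {μ μ' : Measure ℝ}

theorem IsJacobiSystem.X_mul_mem_span (hP : IsJacobiSystem a b P) {Q : Polynomial ℝ}
    (hQ : Q ∈ Submodule.span ℝ (Set.range P)) : X * Q ∈ Submodule.span ℝ (Set.range P) := by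
  have hmem : ∀ (c : ℝ) n, c • P n ∈ Submodule.span ℝ (Set.range P) := fun c n =>
    Submodule.smul_mem _ c (Submodule.subset_span ⟨n, rfl⟩)
  induction hQ using Submodule.span_induction with
  | mem Q hQ =>
    obtain ⟨_ | n, rfl⟩ := hQ
    · rw [hP.X_mul_zero]
      exact add_mem (hmem _ _) (hmem _ _)
    · rw [hP.X_mul_succ]
      exact add_mem (add_mem (hmem _ _) (hmem _ _)) (hmem _ _)
  | zero => simp
  | add Q R _ _ hQ hR => rw [mul_add]; exact add_mem hQ hR
  | smul c Q _ hQ => rw [mul_smul_comm]; exact Submodule.smul_mem _ c hQ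

theorem IsJacobiSystem.span_eq_top (hP : IsJacobiSystem a b P) :
    Submodule.span ℝ (Set.range P) = ⊤ := by
  have hpow : ∀ n, (X : Polynomial ℝ) ^ n ∈ Submodule.span ℝ (Set.range P) := fun n => by
    induction n with
    | zero => exact Submodule.subset_span ⟨0, by rw [hP.zero, pow_zero]⟩
    | succ n ih => rw [pow_succ']; exact hP.X_mul_mem_span ih
  refine eq_top_iff.2 fun Q _ => ?_
  rw [Q.as_sum_range_C_mul_X_pow]
  refine sum_mem fun i _ => ?_
  rw [← Polynomial.smul_eq_C_mul]
  exact Submodule.smul_mem _ _ (hpow i)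

namespace IsOrthonormalMeasure

theorem integrable_eval (h : IsOrthonormalMeasure P μ) (h0 : P 0 = 1) (n : ℕ) :
    Integrable (fun t => (P n).eval t) μ := by
  simpa [h0] using h.integrable n 0

theorem integral_eval (h : IsOrthonormalMeasure P μ) (h0 : P 0 = 1) (n : ℕ) :
    ∫ t, (P n).eval t ∂μ = if n = 0 then 1 else 0 := by
  simpa [h0] using h.orthonormal n 0

theorem isProbabilityMeasure (h : IsOrthonormalMeasure P μ) (h0 : P 0 = 1) :
    IsProbabilityMeasure μ := by
  have hmass := h.integral_eval h0 0
  simp only [h0, Polynomial.eval_one, integral_const, smul_eq_mul, mul_one, if_true] at hmass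
  exact ⟨(ENNReal.toReal_eq_one_iff _).1 hmass⟩

theorem integrable_polynomial (h : IsOrthonormalMeasure P μ) (hP : IsJacobiSystem a b P)
    (Q : Polynomial ℝ) : Integrable (fun t => Q.eval t) μ := by
  have hQ : Q ∈ Submodule.span ℝ (Set.range P) := hP.span_eq_top ▸ Submodule.mem_top
  induction hQ using Submodule.span_induction with
  | mem Q hQ => obtain ⟨n, rfl⟩ := hQ; exact h.integrable_eval hP.zero n
  | zero => simp
  | add Q R _ _ hQ hR => simp only [Polynomial.eval_add]; exact hQ.add hR
  | smul c Q _ hQ => simp only [Polynomial.eval_smul, smul_eq_mul]; exact hQ.const_mul c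

theorem integral_polynomial_eq (h : IsOrthonormalMeasure P μ) (h' : IsOrthonormalMeasure P μ')
    (hP : IsJacobiSystem a b P) (Q : Polynomial ℝ) :
    ∫ t, Q.eval t ∂μ = ∫ t, Q.eval t ∂μ' := by
  have hQ : Q ∈ Submodule.span ℝ (Set.range P) := hP.span_eq_top ▸ Submodule.mem_top
  induction hQ using Submodule.span_induction with
  | mem Q hQ =>
    obtain ⟨n, rfl⟩ := hQ
    rw [h.integral_eval hP.zero, h'.integral_eval hP.zero]
  | zero => simp
  | add Q R _ _ hQ hR =>
    simp only [Polynomial.eval_add]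
    rw [integral_add (h.integrable_polynomial hP Q) (h.integrable_polynomial hP R),
      integral_add (h'.integrable_polynomial hP Q) (h'.integrable_polynomial hP R), hQ, hR]
  | smul c Q _ hQ => simp only [Polynomial.eval_smul, smul_eq_mul, integral_const_mul, hQ]

end IsOrthonormalMeasure

theorem isSelfAdjoint_aeval {A : Type*} [Ring A] [Algebra ℝ A] [StarRing A] [StarModule ℝ A]
    {T : A} (hT : IsSelfAdjoint T) (Q : Polynomial ℝ) : IsSelfAdjoint (aeval T Q) := by
  induction Q using Polynomial.induction_on' with
  | add Q R hQ hR => rw [map_add]; exact hQ.add hR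
  | monomial n r =>
    rw [Polynomial.aeval_monomial, ← Algebra.smul_def]
    exact (IsSelfAdjoint.all r).smul (hT.pow n)

namespace IsJacobiSystem

variable {H : Type*} [NormedAddCommGroup H] [InnerProductSpace ℂ H] {e : ℕ → H}

theorem aeval_apply_zero (hP : IsJacobiSystem a b P) {T : H →L[ℂ] H}
    (hT0 : T (e 0) = b 0 • e 0 + a 0 • e 1)
    (hTsucc : ∀ n, T (e (n + 1)) = a n • e n + b (n + 1) • e (n + 1) + a (n + 1) • e (n + 2)) :
    ∀ n, aeval T (P n) (e 0) = e n
  | 0 => by simp [hP.zero]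
  | 1 => by
    have hrec := congrArg (fun Q => aeval T Q (e 0)) hP.X_mul_zero
    simp only [map_mul, map_add, map_smul, Polynomial.aeval_X, mul_apply_eq_comp, add_apply,
      smul_apply, hP.aeval_apply_zero hT0 hTsucc 0, hT0] at hrec
    exact (smul_right_injective H (hP.ne_zero 0) (add_left_cancel hrec)).symm
  | n + 2 => by
    have hrec := congrArg (fun Q => aeval T Q (e 0)) (hP.X_mul_succ n)
    simp only [map_mul, map_add, map_smul, Polynomial.aeval_X, mul_apply_eq_comp, add_apply,
      smul_apply, hP.aeval_apply_zero hT0 hTsucc n, hP.aeval_apply_zero hT0 hTsucc (n + 1),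
      hTsucc] at hrec
    exact (smul_right_injective H (hP.ne_zero (n + 1)) (add_left_cancel hrec)).symm

theorem isOrthonormalMeasure_spectralMeasure [CompleteSpace H] (hP : IsJacobiSystem a b P)
    (he : Orthonormal ℂ e) (hsum : Summable (jacobiSummand e a b)) :
    IsOrthonormalMeasure P
      (spectralMeasure (jacobiOperator e a b) (isSelfAdjoint_jacobiOperator e a b) (e 0)) := by
  have hT := isSelfAdjoint_jacobiOperator e a b
  have haeval := hP.aeval_apply_zero (jacobiOperator_apply_zero he hsum)
    (jacobiOperator_apply_succ he hsum)
  obtain ⟨R, hR⟩ := exists_ae_abs_le_spectralMeasure hT (e 0)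
  refine ⟨fun n m => integrable_of_continuous_of_ae_abs_le hR (by fun_prop), fun n m => ?_⟩
  simp only [← Polynomial.eval_mul]
  rw [integral_polynomial_spectralMeasure, map_mul, mul_apply_eq_comp,
    ← ContinuousLinearMap.adjoint_inner_left, ← ContinuousLinearMap.star_eq_adjoint,
    (isSelfAdjoint_aeval hT _).star_eq, haeval, haeval, orthonormal_iff_ite.1 he]
  split_ifs <;> simp

theorem existsUnique_isOrthonormalMeasure (hP : IsJacobiSystem a b P)
    (ha : Summable fun n => |a n|) (hb : Summable fun n => |b n|) :
    ∃! μ, IsOrthonormalMeasure P μ := by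
  obtain ⟨e, he⟩ : ∃ e : ℕ → lp (fun _ : ℕ => ℂ) 2, Orthonormal ℂ e :=
    ⟨_, (HilbertBasis.ofRepr (LinearIsometryEquiv.refl ℂ _)).orthonormal⟩
  have hμ := hP.isOrthonormalMeasure_spectralMeasure he (summable_jacobiSummand he ha hb)
  obtain ⟨R, hR⟩ := exists_ae_abs_le_spectralMeasure (isSelfAdjoint_jacobiOperator e a b) (e 0)
  refine ⟨_, hμ, fun μ' hμ' => ?_⟩
  have := hμ'.isProbabilityMeasure hP.zero
  exact (measure_eq_of_integral_polynomial_eq hR (hμ'.integrable_polynomial hP)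
    (hμ.integral_polynomial_eq hμ' hP)).symm

end IsJacobiSystem

end JacobiSystem

section SecondKind

open Polynomial (X)

/-- The function of the second kind `z ↦ ∫ P(t) / (z - t) dμ(t)` of the polynomial `P`; for `P = 1`
it is the Stieltjes transform of `μ`. -/
noncomputable def secondKind (μ : Measure ℝ) (z : ℂ) (P : Polynomial ℝ) : ℂ :=
  ∫ t, ((P.eval t : ℝ) : ℂ) / (z - (t : ℂ)) ∂μ

variable {μ : Measure ℝ} {z : ℂ}

theorem isClosed_ofReal_image_support (μ : Measure ℝ) :
    IsClosed (Complex.ofReal '' μ.support) :=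
  Complex.isometry_ofReal.isClosedEmbedding.isClosedMap _ Measure.isClosed_support

theorem exists_pos_ae_le_norm_sub (hz : z ∉ Complex.ofReal '' μ.support) :
    ∃ δ > 0, ∀ᵐ t ∂μ, δ ≤ ‖z - ((t : ℝ) : ℂ)‖ := by
  obtain ⟨δ, hδ, hball⟩ :=
    Metric.isOpen_iff.1 (isClosed_ofReal_image_support μ).isOpen_compl z hz
  refine ⟨δ, hδ, ?_⟩
  filter_upwards [Measure.support_mem_ae (μ := μ)] with t ht
  by_contra! hlt
  refine hball (a := (t : ℂ)) ?_ ⟨t, ht, rfl⟩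
  rwa [Metric.mem_ball, dist_comm, Complex.dist_eq]

theorem integrable_ofReal_div_sub (hz : z ∉ Complex.ofReal '' μ.support) {f : ℝ → ℝ}
    (hf : Integrable f μ) : Integrable (fun t => (f t : ℂ) / (z - (t : ℂ))) μ := by
  obtain ⟨δ, hδ, hle⟩ := exists_pos_ae_le_norm_sub hz
  simp only [div_eq_mul_inv]
  refine hf.ofReal.mul_bdd (c := δ⁻¹)
    (by fun_prop : Measurable fun t : ℝ => (z - (t : ℂ))⁻¹).aestronglyMeasurable ?_
  filter_upwards [hle] with t ht
  rw [norm_inv]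
  exact inv_anti₀ hδ ht

theorem secondKind_add (hz : z ∉ Complex.ofReal '' μ.support) {P Q : Polynomial ℝ}
    (hP : Integrable (fun t => P.eval t) μ) (hQ : Integrable (fun t => Q.eval t) μ) :
    secondKind μ z (P + Q) = secondKind μ z P + secondKind μ z Q := by
  simp only [secondKind, Polynomial.eval_add, Complex.ofReal_add, add_div]
  exact integral_add (integrable_ofReal_div_sub hz hP) (integrable_ofReal_div_sub hz hQ)

theorem secondKind_smul (μ : Measure ℝ) (z : ℂ) (c : ℝ) (P : Polynomial ℝ) :
    secondKind μ z (c • P) = c * secondKind μ z P := by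
  simp only [secondKind, Polynomial.eval_smul, smul_eq_mul, Complex.ofReal_mul, mul_div_assoc,
    integral_const_mul]

theorem secondKind_X_mul (hz : z ∉ Complex.ofReal '' μ.support) {P : Polynomial ℝ}
    (hP : Integrable (fun t => P.eval t) μ) :
    secondKind μ z (X * P) = z * secondKind μ z P - ((∫ t, P.eval t ∂μ : ℝ) : ℂ) := by
  obtain ⟨δ, hδ, hle⟩ := exists_pos_ae_le_norm_sub hz
  have hPc : Integrable (fun t => ((P.eval t : ℝ) : ℂ)) μ := hP.ofReal
  rw [secondKind, secondKind, ← integral_const_mul, ← integral_complex_ofReal,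
    ← integral_sub ((integrable_ofReal_div_sub hz hP).const_mul z) hPc]
  refine integral_congr_ae ?_
  filter_upwards [hle] with t ht
  have hne : z - (t : ℂ) ≠ 0 := norm_pos_iff.1 (hδ.trans_le ht)
  simp only [Polynomial.eval_mul, Polynomial.eval_X, Complex.ofReal_mul]
  field_simp
  ring

theorem continuousAt_secondKind_one [IsFiniteMeasure μ] (hz : z ∉ Complex.ofReal '' μ.support) :
    ContinuousAt (fun w => secondKind μ w 1) z := by
  obtain ⟨δ, hδ, hle⟩ := exists_pos_ae_le_norm_sub hz
  simp only [secondKind, Polynomial.eval_one, Complex.ofReal_one]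
  refine continuousAt_of_dominated (bound := fun _ => (δ / 2)⁻¹) ?_ ?_ (integrable_const _) ?_
  · exact Eventually.of_forall fun w =>
      (by fun_prop : Measurable fun t : ℝ => 1 / (w - (t : ℂ))).aestronglyMeasurable
  · filter_upwards [Metric.ball_mem_nhds z (half_pos hδ)] with w hw
    filter_upwards [hle] with t ht
    rw [norm_div, norm_one, one_div]
    refine inv_anti₀ (half_pos hδ) ?_
    have htri := norm_sub_le_norm_sub_add_norm_sub z w (t : ℂ)
    rw [Metric.mem_ball, dist_comm, Complex.dist_eq] at hw
    linarith
  · filter_upwards [hle] with t ht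
    have hne : z - (t : ℂ) ≠ 0 := norm_pos_iff.1 (hδ.trans_le ht)
    fun_prop (disch := exact hne)

variable {a b : ℕ → ℝ} {P : ℕ → Polynomial ℝ}

theorem IsOrthonormalMeasure.exists_norm_secondKind_le [IsFiniteMeasure μ]
    (h : IsOrthonormalMeasure P μ) (hz : z ∉ Complex.ofReal '' μ.support) :
    ∃ C, ∀ n, ‖secondKind μ z (P n)‖ ≤ C := by
  obtain ⟨δ, hδ, hle⟩ := exists_pos_ae_le_norm_sub hz
  refine ⟨(μ.real Set.univ + 1) * δ⁻¹, fun n => ?_⟩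
  have hint := (integrable_const (μ := μ) (1 : ℝ)).add (h.integrable n n)
  calc ‖secondKind μ z (P n)‖
      ≤ ∫ t, (1 + (P n).eval t * (P n).eval t) * δ⁻¹ ∂μ := by
        refine norm_integral_le_of_norm_le (hint.mul_const _) ?_
        filter_upwards [hle] with t ht
        rw [norm_div, Complex.norm_real, Real.norm_eq_abs, div_eq_mul_inv]
        refine mul_le_mul ?_ (inv_anti₀ hδ ht) (by positivity)
          (add_nonneg zero_le_one (mul_self_nonneg _))
        rw [← abs_mul_abs_self]
        nlinarith [sq_nonneg (|(P n).eval t| - 1)]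
    _ = (μ.real Set.univ + 1) * δ⁻¹ := by
        rw [integral_mul_const, integral_add (integrable_const 1) (h.integrable n n),
          h.orthonormal, if_pos rfl, integral_const, smul_eq_mul, mul_one]

namespace IsJacobiSystem

theorem secondKind_zero (hP : IsJacobiSystem a b P) (h : IsOrthonormalMeasure P μ)
    (hz : z ∉ Complex.ofReal '' μ.support) :
    b 0 * secondKind μ z (P 0) + a 0 * secondKind μ z (P 1) = z * secondKind μ z (P 0) - 1 := by
  have hrec := secondKind_X_mul hz (h.integrable_polynomial hP (P 0))
  rwa [hP.X_mul_zero, secondKind_add hz (h.integrable_polynomial hP _)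
    (h.integrable_polynomial hP _), secondKind_smul, secondKind_smul, h.integral_eval hP.zero,
    if_pos rfl, Complex.ofReal_one] at hrec

theorem secondKind_succ (hP : IsJacobiSystem a b P) (h : IsOrthonormalMeasure P μ)
    (hz : z ∉ Complex.ofReal '' μ.support) (n : ℕ) :
    a n * secondKind μ z (P n) + b (n + 1) * secondKind μ z (P (n + 1))
      + a (n + 1) * secondKind μ z (P (n + 2)) = z * secondKind μ z (P (n + 1)) := by
  have hrec := secondKind_X_mul hz (h.integrable_polynomial hP (P (n + 1)))
  rwa [hP.X_mul_succ, secondKind_add hz (h.integrable_polynomial hP _)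
    (h.integrable_polynomial hP _), secondKind_add hz (h.integrable_polynomial hP _)
    (h.integrable_polynomial hP _), secondKind_smul, secondKind_smul, secondKind_smul,
    h.integral_eval hP.zero, if_neg n.succ_ne_zero, Complex.ofReal_zero, sub_zero] at hrec

theorem integrable_sq_mul_eval_sq (hP : IsJacobiSystem a b P) (h : IsOrthonormalMeasure P μ)
    (n : ℕ) : Integrable (fun t => t ^ 2 * ((P n).eval t * (P n).eval t)) μ :=
  (h.integrable_polynomial hP (X ^ 2 * (P n * P n))).congr (.of_forall fun t => by simp)

theorem integral_sq_mul_eval_sq_le (hP : IsJacobiSystem a b P) (h : IsOrthonormalMeasure P μ)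
    (n : ℕ) : ∫ t, t ^ 2 * ((P (n + 1)).eval t * (P (n + 1)).eval t) ∂μ ≤
      3 * (a n ^ 2 + b (n + 1) ^ 2 + a (n + 1) ^ 2) := by
  have hrec : ∀ t, t * (P (n + 1)).eval t =
      a n * (P n).eval t + b (n + 1) * (P (n + 1)).eval t + a (n + 1) * (P (n + 2)).eval t :=
    fun t => by simpa using congrArg (Polynomial.eval t) (hP.X_mul_succ n)
  have hint : ∀ (c : ℝ) k, Integrable (fun t => c * ((P k).eval t * (P k).eval t)) μ :=
    fun c k => (h.integrable k k).const_mul c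
  calc ∫ t, t ^ 2 * ((P (n + 1)).eval t * (P (n + 1)).eval t) ∂μ
      ≤ ∫ t, (3 * a n ^ 2 * ((P n).eval t * (P n).eval t)
          + 3 * b (n + 1) ^ 2 * ((P (n + 1)).eval t * (P (n + 1)).eval t))
          + 3 * a (n + 1) ^ 2 * ((P (n + 2)).eval t * (P (n + 2)).eval t) ∂μ := by
        refine integral_mono (hP.integrable_sq_mul_eval_sq h (n + 1))
          (((hint _ _).add (hint _ _)).add (hint _ _)) fun t => ?_
        have hsq := congrArg (· ^ 2) (hrec t)
        simp only at hsq ⊢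
        nlinarith [sq_nonneg (a n * (P n).eval t - b (n + 1) * (P (n + 1)).eval t),
          sq_nonneg (a n * (P n).eval t - a (n + 1) * (P (n + 2)).eval t),
          sq_nonneg (b (n + 1) * (P (n + 1)).eval t - a (n + 1) * (P (n + 2)).eval t)]
    _ = 3 * (a n ^ 2 + b (n + 1) ^ 2 + a (n + 1) ^ 2) := by
        rw [integral_add (by exact (hint _ _).add (hint _ _)) (hint _ _),
          integral_add (hint _ _) (hint _ _)]
        simp only [integral_const_mul, h.orthonormal, if_true]
        ring

theorem zero_mem_support (hP : IsJacobiSystem a b P) (h : IsOrthonormalMeasure P μ)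
    (ha : Tendsto a atTop (𝓝 0)) (hb : Tendsto b atTop (𝓝 0)) : (0 : ℝ) ∈ μ.support := by
  by_contra hzero
  obtain ⟨δ, hδ, hle⟩ := exists_pos_ae_le_norm_sub (μ := μ) (z := 0) (by simpa using hzero)
  have hbound : ∀ n, δ ^ 2 ≤ 3 * (a n ^ 2 + b (n + 1) ^ 2 + a (n + 1) ^ 2) := fun n => by
    refine le_trans ?_ (hP.integral_sq_mul_eval_sq_le h n)
    have hmono := integral_mono_ae ((h.integrable (n + 1) (n + 1)).const_mul (δ ^ 2))
      (hP.integrable_sq_mul_eval_sq h (n + 1))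
      (hle.mono fun t ht => mul_le_mul_of_nonneg_right (?_ : δ ^ 2 ≤ t ^ 2) (mul_self_nonneg _))
    · rwa [integral_const_mul, h.orthonormal, if_pos rfl, mul_one] at hmono
    · rw [zero_sub, norm_neg, Complex.norm_real, Real.norm_eq_abs] at ht
      rw [← sq_abs t]
      exact pow_le_pow_left₀ hδ.le ht 2
  have hlim := ((((ha.pow 2).add (((tendsto_add_atTop_iff_nat 1).2 hb).pow 2)).add
    (((tendsto_add_atTop_iff_nat 1).2 ha).pow 2))).const_mul 3
  have hle_zero : δ ^ 2 ≤ 0 := by simpa using ge_of_tendsto' hlim hbound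
  exact absurd hle_zero (by simpa using hδ.ne')

end IsJacobiSystem

end SecondKind

section QPochhammer

variable {a p : ℂ}

theorem summable_norm_neg_mul_pow (a : ℂ) (hp : ‖p‖ < 1) :
    Summable fun k : ℕ => ‖-(a * p ^ k)‖ := by
  simpa using (summable_geometric_of_lt_one (norm_nonneg p) hp).mul_left ‖a‖

theorem tendsto_qPoch (a : ℂ) (hp : ‖p‖ < 1) :
    Tendsto (qPoch a p) atTop (𝓝 (qPochInf a p)) := by
  have hmul : Multipliable fun k : ℕ => 1 + -(a * p ^ k) :=
    multipliable_one_add_of_summable (summable_norm_neg_mul_pow a hp)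
  simp only [← sub_eq_add_neg] at hmul
  exact hmul.tendsto_prod_tprod_nat

theorem qPoch_succ (a p : ℂ) (n : ℕ) : qPoch a p (n + 1) = qPoch a p n * (1 - a * p ^ n) :=
  Finset.prod_range_succ _ _

theorem qPochInf_ne_zero (hp : ‖p‖ < 1) (h : ∀ k : ℕ, 1 - a * p ^ k ≠ 0) :
    qPochInf a p ≠ 0 := by
  simpa only [qPochInf, sub_eq_add_neg] using
    tprod_one_add_ne_zero_of_summable (f := fun k : ℕ => -(a * p ^ k))
      (fun k => by simpa [sub_eq_add_neg] using h k) (summable_norm_neg_mul_pow a hp)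

theorem exists_mul_pow_eq_one_of_qPochInf_eq_zero (hp : ‖p‖ < 1) (h : qPochInf a p = 0) :
    ∃ k : ℕ, a * p ^ k = 1 := by
  by_contra! hne
  exact qPochInf_ne_zero hp (fun k => sub_ne_zero.2 (hne k).symm) h

theorem one_sub_mul_pow_self_ne_zero (hp : ‖p‖ < 1) (k : ℕ) : 1 - p * p ^ k ≠ 0 := by
  rw [← pow_succ', sub_ne_zero]
  intro h
  have hlt : ‖p ^ (k + 1)‖ < 1 := by
    rw [norm_pow]
    exact pow_lt_one₀ (norm_nonneg p) hp k.succ_ne_zero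
  simp [← h] at hlt

end QPochhammer

section Theta

variable {p z : ℂ}

/-- The theta function `(-z⁻¹;p)_∞ (-pz;p)_∞`; at `p = q²` it is `lommelTheta q z`. -/
noncomputable def qTheta (p z : ℂ) : ℂ :=
  qPochInf (-z⁻¹) p * qPochInf (-(p * z)) p

/-- The `j`-th term `p^{j(j+1)/2} z^j` of the bilateral theta series (the division is exact). -/
noncomputable def qThetaTerm (p z : ℂ) (j : ℤ) : ℂ :=
  p ^ (j * (j + 1) / 2) * z ^ j

theorem exists_eq_neg_zpow_of_qTheta_eq_zero (hp0 : p ≠ 0) (hp : ‖p‖ < 1) (hz : z ≠ 0)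
    (h : qTheta p z = 0) : ∃ m : ℤ, z = -p ^ m := by
  rcases mul_eq_zero.1 h with h | h
  · obtain ⟨k, hk⟩ := exists_mul_pow_eq_one_of_qPochInf_eq_zero hp h
    refine ⟨k, ?_⟩
    rw [zpow_natCast]
    field_simp at hk
    linear_combination -hk
  · obtain ⟨k, hk⟩ := exists_mul_pow_eq_one_of_qPochInf_eq_zero hp h
    refine ⟨-(k + 1 : ℕ), ?_⟩
    rw [zpow_neg, zpow_natCast, pow_succ]
    field_simp
    linear_combination -hk

theorem summable_of_succ_eq_mul {f r : ℕ → ℂ} (hr : Tendsto r atTop (𝓝 0))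
    (hf : ∀ k, f (k + 1) = r k * f k) : Summable f := by
  refine summable_of_ratio_norm_eventually_le (r := 1 / 2) (by norm_num) ?_
  filter_upwards [hr.norm.eventually_le_const (by norm_num : ‖(0 : ℂ)‖ < 1 / 2)] with k hk
  rw [hf, norm_mul]
  gcongr

theorem tendsto_pow_succ_mul_zero (hp : ‖p‖ < 1) (c : ℂ) :
    Tendsto (fun k : ℕ => p ^ (k + 1) * c) atTop (𝓝 0) := by
  simpa using ((tendsto_add_atTop_iff_nat 1).2
    (tendsto_pow_atTop_nhds_zero_of_norm_lt_one hp)).mul_const c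

theorem qThetaTerm_add_one (hp0 : p ≠ 0) (hz : z ≠ 0) (j : ℤ) :
    qThetaTerm p z (j + 1) = p ^ (j + 1) * z * qThetaTerm p z j := by
  have hexp : (j + 1) * (j + 1 + 1) / 2 = j * (j + 1) / 2 + (j + 1) := by
    rw [← Int.add_mul_ediv_right _ _ two_ne_zero]
    ring_nf
  rw [qThetaTerm, qThetaTerm, hexp, zpow_add₀ hp0 _ (j + 1), zpow_add_one₀ hz]
  ring

theorem summable_qThetaTerm (hp0 : p ≠ 0) (hp : ‖p‖ < 1) (hz : z ≠ 0) :
    Summable (qThetaTerm p z) := by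
  refine .of_nat_of_neg_add_one ?_ ?_
  · refine summable_of_succ_eq_mul (tendsto_pow_succ_mul_zero hp z) fun k => ?_
    rw [Nat.cast_add_one, qThetaTerm_add_one hp0 hz]
    norm_cast
  · refine summable_of_succ_eq_mul (tendsto_pow_succ_mul_zero hp z⁻¹) fun k => ?_
    have hstep := qThetaTerm_add_one hp0 hz (-(((k + 1 : ℕ) : ℤ) + 1))
    rw [neg_add_rev, neg_add_cancel_comm, zpow_neg, zpow_natCast, Nat.cast_add_one] at hstep
    rw [hstep, Nat.cast_add_one, neg_add_rev (k + 1 : ℤ)]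
    field_simp

theorem tendsto_tsum_mul_shift {G : ℤ → ℂ} (hG : Summable G) {a : ℕ → ℂ} {l : ℂ}
    (ha : Tendsto a atTop (𝓝 l)) :
    Tendsto (fun n : ℕ => ∑' k : ℕ, a k * G (k - n)) atTop (𝓝 (l * ∑' j, G j)) := by
  set c : ℤ → ℂ := Function.extend Nat.cast a 0 with hc
  have hc_nat : ∀ k : ℕ, c k = a k := Nat.cast_injective.extend_apply a 0
  obtain ⟨C, hC⟩ := (Metric.isBounded_range_of_tendsto a ha).exists_norm_le
  have hc_le : ∀ j, ‖c j‖ ≤ C := fun j => by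
    by_cases hj : ∃ k : ℕ, (k : ℤ) = j
    · obtain ⟨k, rfl⟩ := hj
      exact hc_nat k ▸ hC _ ⟨k, rfl⟩
    · rw [hc, Function.extend_apply' _ _ _ hj]
      simpa using (norm_nonneg (a 0)).trans (hC _ ⟨0, rfl⟩)
  have hshift : ∀ n : ℕ, ∑' k : ℕ, a k * G (k - n) = ∑' j, c (j + n) * G j := fun n => by
    rw [← (Equiv.subRight (n : ℤ)).tsum_eq, ← tsum_extend_zero (Nat.cast_injective (R := ℤ))]
    refine tsum_congr fun j => ?_
    by_cases hj : ∃ k : ℕ, (k : ℤ) = j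
    · obtain ⟨k, rfl⟩ := hj
      simp [Nat.cast_injective.extend_apply, hc_nat]
    · simp [hc, Function.extend_apply' _ _ _ hj]
  have hc_lim : Tendsto c atTop (𝓝 l) := by
    rw [← Nat.map_cast_int_atTop, tendsto_map'_iff]
    exact ha.congr fun k => (hc_nat k).symm
  simp only [hshift, ← tsum_mul_left]
  refine tendsto_tsum_of_dominated_convergence (hG.norm.mul_left C)
    (fun j => (hc_lim.comp (tendsto_atTop_add_const_left _ j
      tendsto_natCast_atTop_atTop)).mul_const _) (.of_forall fun n j => ?_)
  rw [norm_mul]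
  gcongr
  exact hc_le _

end Theta

section QBesselSeries

variable {p b d y z : ℂ}

/-- The `k`-th Taylor coefficient of `qBesselSeries p b`. -/
noncomputable def qBesselCoeff (p b : ℂ) (k : ℕ) : ℂ :=
  p ^ (k + 1).choose 2 / (qPoch p p k * qPoch b p k)

/-- The basic hypergeometric series `₁φ₁(0; b; p, -py) = ∑ p^{k(k+1)/2} y^k / ((p;p)_k (b;p)_k)`;
it gives `I_ν(x; p)` at `b = p^{ν+1}` and `y = x²`. -/
noncomputable def qBesselSeries (p b y : ℂ) : ℂ :=
  ∑' k, qBesselCoeff p b k * y ^ k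

theorem choose_two_succ (n : ℕ) : (n + 1).choose 2 = n + n.choose 2 := by
  rw [Nat.choose_succ_succ' n 1, Nat.choose_one_right]

theorem qBesselCoeff_zero (p b : ℂ) : qBesselCoeff p b 0 = 1 := by
  simp [qBesselCoeff, qPoch]

theorem qBesselCoeff_succ (p b : ℂ) (k : ℕ) :
    qBesselCoeff p b (k + 1) =
      p ^ (k + 1) / ((1 - p * p ^ k) * (1 - b * p ^ k)) * qBesselCoeff p b k := by
  rw [qBesselCoeff, qBesselCoeff, choose_two_succ, pow_add, qPoch_succ, qPoch_succ,
    mul_mul_mul_comm, div_mul_div_comm, mul_comm (qPoch p p k * qPoch b p k)]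

theorem summable_qBesselSeries (hp : ‖p‖ < 1) (b y : ℂ) :
    Summable fun k => qBesselCoeff p b k * y ^ k := by
  have hden : Tendsto (fun k : ℕ => (1 - p * p ^ k) * (1 - b * p ^ k)) atTop (𝓝 1) := by
    have hpow := tendsto_pow_atTop_nhds_zero_of_norm_lt_one hp
    simpa using ((hpow.const_mul p).const_sub 1).mul ((hpow.const_mul b).const_sub 1)
  have hratio := (tendsto_pow_succ_mul_zero hp y).div hden one_ne_zero
  rw [zero_div] at hratio
  refine summable_of_succ_eq_mul hratio fun k => ?_
  rw [qBesselCoeff_succ, pow_succ y, Pi.div_apply]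
  ring

theorem qBesselSeries_zero (p b : ℂ) : qBesselSeries p b 0 = 1 := by
  rw [qBesselSeries, tsum_eq_single 0 fun k hk => by simp [hk]]
  simp [qBesselCoeff_zero]

theorem differentiable_qBesselSeries (hp : ‖p‖ < 1) (b : ℂ) :
    Differentiable ℂ (qBesselSeries p b) := fun y => by
  have hy : y ∈ Metric.ball (0 : ℂ) (‖y‖ + 1) := by simp
  have hdiff : DifferentiableOn ℂ (qBesselSeries p b) (Metric.ball 0 (‖y‖ + 1)) :=
    Complex.differentiableOn_tsum_of_summable_norm
      (summable_qBesselSeries hp b ((‖y‖ + 1 : ℝ) : ℂ)).norm (fun k => by fun_prop)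
      Metric.isOpen_ball fun k w hw => by
        rw [norm_mul, norm_mul, norm_pow, norm_pow, Complex.norm_of_nonneg (by positivity)]
        gcongr
        exact (mem_ball_zero_iff.1 hw).le
  exact hdiff.differentiableAt (Metric.isOpen_ball.mem_nhds hy)

theorem qBesselSeries_qDifference (hp : ‖p‖ < 1) (hd : ∀ k : ℕ, 1 - p * d * p ^ k ≠ 0) (y : ℂ) :
    qBesselSeries p (p * d) y + d * qBesselSeries p (p * d) (p ^ 2 * y) =
      (1 + d + p * y) * qBesselSeries p (p * d) (p * y) := by
  have hsum := summable_qBesselSeries hp (p * d)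
  have hcoeff : ∀ k, qBesselCoeff p (p * d) (k + 1) * ((1 - p ^ (k + 1)) * (1 - d * p ^ (k + 1)))
      = p ^ (k + 1) * qBesselCoeff p (p * d) k := fun k => by
    have hne := mul_ne_zero (one_sub_mul_pow_self_ne_zero hp k) (hd k)
    have hswap : 1 - d * p ^ (k + 1) = 1 - p * d * p ^ k := by ring
    rw [qBesselCoeff_succ, hswap, pow_succ', div_mul_eq_mul_div, div_mul_cancel₀ _ hne]
  have hexpand : qBesselSeries p (p * d) y + d * qBesselSeries p (p * d) (p ^ 2 * y)
      - (1 + d) * qBesselSeries p (p * d) (p * y) =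
      ∑' k, qBesselCoeff p (p * d) k * ((1 - p ^ k) * (1 - d * p ^ k)) * y ^ k := by
    simp only [qBesselSeries]
    rw [← tsum_mul_left, ← tsum_mul_left, ← (hsum y).tsum_add ((hsum _).mul_left d),
      ← ((hsum y).add ((hsum _).mul_left d)).tsum_sub ((hsum _).mul_left _)]
    exact tsum_congr fun k => by ring
  have hshift : ∑' k, qBesselCoeff p (p * d) k * ((1 - p ^ k) * (1 - d * p ^ k)) * y ^ k =
      p * y * qBesselSeries p (p * d) (p * y) := by
    rw [qBesselSeries, ← tsum_mul_left, tsum_eq_zero_add']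
    · simp only [pow_zero, sub_self, zero_mul, mul_zero, zero_add, hcoeff]
      exact tsum_congr fun k => by ring
    · simp only [hcoeff]
      exact ((hsum (p * y)).mul_left (p * y)).congr fun k => by ring
  linear_combination hexpand + hshift

theorem qBesselSeries_base_zero_scaled (hp0 : p ≠ 0) (hp : ‖p‖ < 1) (hz : z ≠ 0) (n : ℕ) :
    z⁻¹ ^ n * p ^ n.choose 2 * qBesselSeries p 0 (p⁻¹ ^ n * z) =
      qPoch (-z⁻¹) p n * qBesselSeries p 0 z := by
  induction n with
  | zero => simp [qPoch]
  | succ n ih =>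
    have hstep := qBesselSeries_qDifference (d := 0) hp (by simp) (p⁻¹ ^ (n + 1) * z)
    have hmul : p * (p⁻¹ ^ (n + 1) * z) = p⁻¹ ^ n * z := by
      rw [pow_succ']
      field_simp
    rw [mul_zero, zero_mul, add_zero, add_zero, hmul] at hstep
    have hfactor : z⁻¹ * p ^ n * (1 + p⁻¹ ^ n * z) = 1 - -z⁻¹ * p ^ n := by
      rw [inv_pow]
      field_simp
      ring
    rw [hstep, qPoch_succ, ← hfactor, choose_two_succ, pow_add, pow_succ]
    linear_combination z⁻¹ * p ^ n * (1 + p⁻¹ ^ n * z) * ih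

theorem qBesselSeries_base_zero_eq_qPochInf (hp : ‖p‖ < 1) (y : ℂ) :
    qBesselSeries p 0 y = qPochInf (-(p * y)) p := by
  have hprod : ∀ n : ℕ, qBesselSeries p 0 y =
      qPoch (-(p * y)) p n * qBesselSeries p 0 (p ^ n * y) := fun n => by
    induction n with
    | zero => simp [qPoch]
    | succ n ih =>
      have hstep := qBesselSeries_qDifference (d := 0) hp (by simp) (p ^ n * y)
      rw [mul_zero, zero_mul, add_zero, add_zero, ← mul_assoc, ← pow_succ'] at hstep
      rw [ih, hstep, qPoch_succ]
      ring
  have hlim : Tendsto (fun n : ℕ => qBesselSeries p 0 (p ^ n * y)) atTop (𝓝 1) := by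
    have harg : Tendsto (fun n : ℕ => p ^ n * y) atTop (𝓝 0) := by
      simpa using (tendsto_pow_atTop_nhds_zero_of_norm_lt_one hp).mul_const y
    rw [← qBesselSeries_zero p 0]
    exact ((differentiable_qBesselSeries hp 0).continuous.tendsto 0).comp harg
  have hconst := (tendsto_qPoch (-(p * y)) hp).mul hlim
  simp only [← hprod, mul_one] at hconst
  exact tendsto_nhds_unique tendsto_const_nhds hconst

theorem tendsto_qBesselSeries_base_zero_scaled (hp0 : p ≠ 0) (hp : ‖p‖ < 1) (hz : z ≠ 0) :
    Tendsto (fun n : ℕ => z⁻¹ ^ n * p ^ n.choose 2 * qBesselSeries p 0 (p⁻¹ ^ n * z)) atTop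
      (𝓝 (qTheta p z)) := by
  simp only [qBesselSeries_base_zero_scaled hp0 hp hz, qTheta,
    ← qBesselSeries_base_zero_eq_qPochInf hp z]
  exact (tendsto_qPoch (-z⁻¹) hp).mul_const _

theorem qThetaTerm_sub_natCast (hp0 : p ≠ 0) (hz : z ≠ 0) (k n : ℕ) :
    qThetaTerm p z (k - n) =
      z⁻¹ ^ n * p ^ n.choose 2 * (p ^ (k + 1).choose 2 * (p⁻¹ ^ n * z) ^ k) := by
  induction n with
  | zero =>
    have hexp : (k : ℤ) * (k + 1) / 2 = ((k + 1).choose 2 : ℕ) := by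
      rw [Nat.choose_two_right, mul_comm]
      push_cast
      rfl
    simp [qThetaTerm, hexp]
  | succ n ih =>
    have hstep := qThetaTerm_add_one hp0 hz ((k : ℤ) - (n + 1 : ℕ))
    have hsub : (k : ℤ) - (n + 1 : ℕ) + 1 = k - n := by push_cast; ring
    rw [hsub, ih, zpow_sub₀ hp0, zpow_natCast, zpow_natCast] at hstep
    have hfactor : p ^ k / p ^ n * z ≠ 0 := by positivity
    have hpow : (p⁻¹ ^ (n + 1) * z) ^ k = (p ^ k)⁻¹ * (p⁻¹ ^ n * z) ^ k := by
      rw [pow_succ', mul_assoc, mul_pow, inv_pow]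
    rw [← mul_right_inj' hfactor, ← hstep, hpow, choose_two_succ n, pow_add p,
      pow_succ z⁻¹]
    field_simp

theorem tendsto_qBesselSeries_scaled_tsum (hp0 : p ≠ 0) (hp : ‖p‖ < 1) (hz : z ≠ 0)
    (hb : ∀ k : ℕ, 1 - b * p ^ k ≠ 0) :
    Tendsto (fun n : ℕ => z⁻¹ ^ n * p ^ n.choose 2 * qBesselSeries p b (p⁻¹ ^ n * z)) atTop
      (𝓝 ((qPochInf p p * qPochInf b p)⁻¹ * ∑' j, qThetaTerm p z j)) := by
  have hlim := ((tendsto_qPoch p hp).mul (tendsto_qPoch b hp)).inv₀ (mul_ne_zero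
    (qPochInf_ne_zero hp (one_sub_mul_pow_self_ne_zero hp)) (qPochInf_ne_zero hp hb))
  refine (tendsto_tsum_mul_shift (summable_qThetaTerm hp0 hp hz) hlim).congr fun n => ?_
  rw [qBesselSeries, ← tsum_mul_left]
  refine tsum_congr fun k => ?_
  rw [qThetaTerm_sub_natCast hp0 hz, qBesselCoeff]
  ring

theorem jacobi_triple_product (hp0 : p ≠ 0) (hp : ‖p‖ < 1) (hz : z ≠ 0) :
    ∑' j, qThetaTerm p z j = qPochInf p p * qTheta p z := by
  have hlim := tendsto_nhds_unique
    (tendsto_qBesselSeries_scaled_tsum (b := 0) hp0 hp hz (by simp))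
    (tendsto_qBesselSeries_base_zero_scaled hp0 hp hz)
  have hpp := qPochInf_ne_zero hp (one_sub_mul_pow_self_ne_zero hp)
  have hzero : qPochInf 0 p = 1 := by simp [qPochInf]
  rw [← hlim, hzero, mul_one, mul_inv_cancel_left₀ hpp]

theorem tendsto_qBesselSeries_scaled (hp0 : p ≠ 0) (hp : ‖p‖ < 1) (hz : z ≠ 0)
    (hb : ∀ k : ℕ, 1 - b * p ^ k ≠ 0) :
    Tendsto (fun n : ℕ => z⁻¹ ^ n * p ^ n.choose 2 * qBesselSeries p b (p⁻¹ ^ n * z)) atTop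
      (𝓝 (qTheta p z / qPochInf b p)) := by
  convert tendsto_qBesselSeries_scaled_tsum hp0 hp hz hb using 2
  have hpp := qPochInf_ne_zero hp (one_sub_mul_pow_self_ne_zero hp)
  rw [jacobi_triple_product hp0 hp hz]
  field_simp

end QBesselSeries

section LommelRecurrence

variable {p d z : ℂ}

/-- The recurrence of the `q⁻¹`-Lommel polynomials after renormalization: the orthonormal
recurrence at `x = z` takes this form, with `p = q²` and `d = q^{2ν}`, once the `n`-th
term is multiplied by `q^{(ν+1)n}`. The index is shifted by one, so that `u 0` plays the part of
the term of index `-1`. -/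
def IsLommelSolution (p d z : ℂ) (u : ℕ → ℂ) : Prop :=
  ∀ n, u (n + 2) + d * u n = (1 + d + p⁻¹ ^ n * z) * u (n + 1)

/-- The solution `n ↦ I_ν(q^{1-n} √z; q²)` of `IsLommelSolution p d z`. -/
noncomputable def lommelSolution (p d z : ℂ) (n : ℕ) : ℂ :=
  qBesselSeries p (p * d) (p * (p⁻¹ ^ n * z))

/-- The solution of `IsLommelSolution p d z` obtained from `lommelSolution` by the symmetry
`ν ↦ -ν` of the recurrence. -/
noncomputable def dualLommelSolution (p d z : ℂ) (n : ℕ) : ℂ :=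
  d ^ n * lommelSolution p d⁻¹ (d⁻¹ * z) n

/-- The combination of `lommelSolution` and `dualLommelSolution` in which the leading terms
at infinity cancel. -/
noncomputable def minimalSolution (p d z : ℂ) (n : ℕ) : ℂ :=
  d⁻¹ * qTheta p z * dualLommelSolution p d z n -
    qPochInf (p * d) p / qPochInf (p * d⁻¹) p * qTheta p (d⁻¹ * z) * lommelSolution p d z n

/-- The Casoratian (discrete Wronskian) of two sequences at the index `0`. -/
def casoratian (u v : ℕ → ℂ) : ℂ :=
  u 1 * v 0 - u 0 * v 1

theorem lommelSolution_succ (hp0 : p ≠ 0) (d z : ℂ) (n : ℕ) :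
    lommelSolution p d z (n + 1) = qBesselSeries p (p * d) (p⁻¹ ^ n * z) := by
  rw [lommelSolution, pow_succ', mul_assoc, mul_inv_cancel_left₀ hp0]

theorem lommelSolution_zero (p d z : ℂ) :
    lommelSolution p d z 0 = qBesselSeries p (p * d) (p * z) := by
  rw [lommelSolution, pow_zero, one_mul]

theorem lommelSolution_one (hp0 : p ≠ 0) (d z : ℂ) :
    lommelSolution p d z 1 = qBesselSeries p (p * d) z := by
  rw [← zero_add 1, lommelSolution_succ hp0, pow_zero, one_mul]

theorem isLommelSolution_lommelSolution (hp0 : p ≠ 0) (hp : ‖p‖ < 1)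
    (hd : ∀ k : ℕ, 1 - p * d * p ^ k ≠ 0) (z : ℂ) :
    IsLommelSolution p d z (lommelSolution p d z) := fun n => by
  have hmul : p * (p⁻¹ ^ (n + 1) * z) = p⁻¹ ^ n * z := by
    rw [pow_succ', mul_assoc, mul_inv_cancel_left₀ hp0]
  have hstep := qBesselSeries_qDifference hp hd (p⁻¹ ^ (n + 1) * z)
  rwa [sq, mul_assoc p p, hmul, ← lommelSolution, ← lommelSolution_succ hp0,
    ← lommelSolution_succ hp0] at hstep

theorem IsLommelSolution.dual (hd0 : d ≠ 0) {u : ℕ → ℂ}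
    (hu : IsLommelSolution p d⁻¹ (d⁻¹ * z) u) :
    IsLommelSolution p d z fun n => d ^ n * u n := fun n => by
  have hstep := hu n
  field_simp at hstep
  linear_combination d ^ (n + 1) * hstep

theorem IsLommelSolution.plucker {u v w : ℕ → ℂ} (hu : IsLommelSolution p d z u)
    (hv : IsLommelSolution p d z v) (hw : IsLommelSolution p d z w) (n : ℕ) :
    u n * casoratian v w + v n * casoratian w u + w n * casoratian u v = 0 := by
  induction n using Nat.twoStepInduction with
  | zero =>
    simp only [casoratian]
    ring
  | one =>
    simp only [casoratian]
    ring
  | more n ih ih_succ =>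
    linear_combination casoratian v w * hu n + casoratian w u * hv n + casoratian u v * hw n -
      d * ih + (1 + d + p⁻¹ ^ n * z) * ih_succ

theorem tendsto_lommelSolution (hp0 : p ≠ 0) (hp : ‖p‖ < 1) (hz : z ≠ 0)
    (hd : ∀ k : ℕ, 1 - p * d * p ^ k ≠ 0) :
    Tendsto (fun n : ℕ => z⁻¹ ^ n * p ^ n.choose 2 * lommelSolution p d z (n + 1)) atTop
      (𝓝 (qTheta p z / qPochInf (p * d) p)) := by
  simpa only [lommelSolution_succ hp0] using tendsto_qBesselSeries_scaled hp0 hp hz hd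

theorem tendsto_dualLommelSolution (hp0 : p ≠ 0) (hp : ‖p‖ < 1) (hz : z ≠ 0) (hd0 : d ≠ 0)
    (hd : ∀ k : ℕ, 1 - p * d⁻¹ * p ^ k ≠ 0) :
    Tendsto (fun n : ℕ => z⁻¹ ^ n * p ^ n.choose 2 * dualLommelSolution p d z (n + 1)) atTop
      (𝓝 (d * (qTheta p (d⁻¹ * z) / qPochInf (p * d⁻¹) p))) := by
  refine ((tendsto_lommelSolution hp0 hp (mul_ne_zero (inv_ne_zero hd0) hz) hd).const_mul
    d).congr fun n => ?_
  rw [dualLommelSolution, mul_inv, inv_inv, mul_pow, pow_succ d]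
  ring

theorem eq_apply_zero_of_comp_mul_eq {f : ℂ → ℂ} (hp : ‖p‖ < 1) (hf : ContinuousAt f 0)
    (hfp : ∀ y, f (p * y) = f y) (y : ℂ) : f y = f 0 := by
  have hiter : ∀ n : ℕ, f (p ^ n * y) = f y := fun n => by
    induction n with
    | zero => simp
    | succ n ih => rw [pow_succ', mul_assoc, hfp, ih]
  have harg : Tendsto (fun n : ℕ => p ^ n * y) atTop (𝓝 0) := by
    simpa using (tendsto_pow_atTop_nhds_zero_of_norm_lt_one hp).mul_const y
  refine tendsto_nhds_unique tendsto_const_nhds ((hf.tendsto.comp harg).congr hiter)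

theorem casoratian_lommelSolution_dual (hp0 : p ≠ 0) (hp : ‖p‖ < 1) (hd0 : d ≠ 0)
    (hd : ∀ k : ℕ, 1 - p * d * p ^ k ≠ 0) (hd' : ∀ k : ℕ, 1 - p * d⁻¹ * p ^ k ≠ 0) (z : ℂ) :
    casoratian (lommelSolution p d z) (dualLommelSolution p d z) = 1 - d := by
  set F := qBesselSeries p (p * d)
  set G := fun y => qBesselSeries p (p * d⁻¹) (d⁻¹ * y)
  have hcont : Continuous fun y => F y * G (p * y) - d * F (p * y) * G y := by
    have hF := (differentiable_qBesselSeries hp (p * d)).continuous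
    have hG := (differentiable_qBesselSeries hp (p * d⁻¹)).continuous
    fun_prop
  have hinv : ∀ y, F (p * y) * G (p * (p * y)) - d * F (p * (p * y)) * G (p * y) =
      F y * G (p * y) - d * F (p * y) * G y := fun y => by
    have hF : F y + d * F (p * (p * y)) = (1 + d + p * y) * F (p * y) := by
      simpa only [sq, mul_assoc] using qBesselSeries_qDifference hp hd y
    have hG : G y + d⁻¹ * G (p * (p * y)) = (1 + d⁻¹ + p * (d⁻¹ * y)) * G (p * y) := by
      simpa only [G, sq, mul_assoc, mul_left_comm d⁻¹] using
        qBesselSeries_qDifference hp hd' (d⁻¹ * y)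
    linear_combination d * F (p * y) * hG - G (p * y) * hF -
      F (p * y) * (G (p * (p * y)) - (1 + p * y) * G (p * y)) * mul_inv_cancel₀ hd0
  have hconst := eq_apply_zero_of_comp_mul_eq hp hcont.continuousAt hinv z
  have hF0 : F 0 = 1 := qBesselSeries_zero p (p * d)
  have hG0 : G 0 = 1 := by simp only [G, mul_zero, qBesselSeries_zero]
  simp only [mul_zero, hF0, hG0, mul_one] at hconst
  simp only [G, mul_left_comm d⁻¹ p] at hconst
  simp only [casoratian, dualLommelSolution, lommelSolution_zero, lommelSolution_one hp0, pow_zero,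
    pow_one, one_mul]
  linear_combination hconst

theorem casoratian_lommelSolution_minimalSolution (hp0 : p ≠ 0) (hp : ‖p‖ < 1) (hd0 : d ≠ 0)
    (hd : ∀ k : ℕ, 1 - p * d * p ^ k ≠ 0) (hd' : ∀ k : ℕ, 1 - p * d⁻¹ * p ^ k ≠ 0) (z : ℂ) :
    casoratian (lommelSolution p d z) (minimalSolution p d z) = (d⁻¹ - 1) * qTheta p z := by
  have hdual := casoratian_lommelSolution_dual hp0 hp hd0 hd hd' z
  rw [casoratian] at hdual ⊢
  rw [minimalSolution, minimalSolution]
  linear_combination d⁻¹ * qTheta p z * hdual - qTheta p z * inv_mul_cancel₀ hd0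

/-- The Plücker relation between `u`, `lommelSolution` and `dualLommelSolution`, divided by the
growth rate of the latter two, leaves this identity in the limit. -/
theorem IsLommelSolution.casoratian_minimalSolution {u : ℕ → ℂ}
    (hu : IsLommelSolution p d z u) (hp0 : p ≠ 0) (hp : ‖p‖ < 1) (hz : z ≠ 0) (hd0 : d ≠ 0)
    (hd : ∀ k : ℕ, 1 - p * d * p ^ k ≠ 0) (hd' : ∀ k : ℕ, 1 - p * d⁻¹ * p ^ k ≠ 0)
    (hlim : Tendsto (fun n : ℕ => z⁻¹ ^ n * p ^ n.choose 2 * u (n + 1)) atTop (𝓝 0)) :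
    casoratian u (minimalSolution p d z) = 0 := by
  have hf := isLommelSolution_lommelSolution hp0 hp hd z
  have hg : IsLommelSolution p d z (dualLommelSolution p d z) :=
    (isLommelSolution_lommelSolution hp0 hp hd' (d⁻¹ * z)).dual hd0
  set f := lommelSolution p d z with hf_def
  set g := dualLommelSolution p d z with hg_def
  have hsum := ((hlim.mul_const (casoratian f g)).add
    ((tendsto_lommelSolution hp0 hp hz hd).mul_const (casoratian g u))).add
    ((tendsto_dualLommelSolution hp0 hp hz hd0 hd').mul_const (casoratian u f))
  have hzero := tendsto_nhds_unique hsum ((tendsto_const_nhds (x := (0 : ℂ))).congr fun n => by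
    linear_combination -(z⁻¹ ^ n * p ^ n.choose 2) * hu.plucker hf hg (n + 1))
  have hpd := qPochInf_ne_zero hp hd
  simp only [casoratian, minimalSolution, ← hf_def, ← hg_def] at hzero ⊢
  field_simp at hzero ⊢
  linear_combination -hzero

theorem one_sub_mul_mul_pow_ne_zero (hp0 : p ≠ 0) (hd : ∀ m : ℤ, d ≠ p ^ m) (k : ℕ) :
    1 - p * d * p ^ k ≠ 0 := fun h => hd (-(k + 1 : ℕ)) <| by
  rw [zpow_neg, zpow_natCast, ← one_div, eq_div_iff (pow_ne_zero _ hp0), pow_succ]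
  linear_combination -h

theorem inv_ne_zpow (hd : ∀ m : ℤ, d ≠ p ^ m) (m : ℤ) : d⁻¹ ≠ p ^ m := fun h =>
  hd (-m) <| by rw [zpow_neg, ← h, inv_inv]

theorem qTheta_inv_mul_ne_zero (hp0 : p ≠ 0) (hp : ‖p‖ < 1) (hz : z ≠ 0) (hd0 : d ≠ 0)
    (hd : ∀ m : ℤ, d ≠ p ^ m) (h : qTheta p z = 0) : qTheta p (d⁻¹ * z) ≠ 0 := fun h' => by
  obtain ⟨m, hm⟩ := exists_eq_neg_zpow_of_qTheta_eq_zero hp0 hp hz h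
  obtain ⟨n, hn⟩ :=
    exists_eq_neg_zpow_of_qTheta_eq_zero hp0 hp (mul_ne_zero (inv_ne_zero hd0) hz) h'
  refine hd (m - n) ?_
  rw [zpow_sub₀ hp0, eq_div_iff (zpow_ne_zero n hp0)]
  field_simp at hn
  linear_combination -hm + hn

theorem IsLommelSolution.minimalSolution_zero_ne_zero {u : ℕ → ℂ}
    (hu : IsLommelSolution p d z u) (hp0 : p ≠ 0) (hp : ‖p‖ < 1) (hz : z ≠ 0) (hd0 : d ≠ 0)
    (hd : ∀ m : ℤ, d ≠ p ^ m)
    (hlim : Tendsto (fun n : ℕ => z⁻¹ ^ n * p ^ n.choose 2 * u (n + 1)) atTop (𝓝 0))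
    (hu0 : u 0 ≠ 0) : minimalSolution p d z 0 ≠ 0 := fun h0 => by
  have hpd := one_sub_mul_mul_pow_ne_zero hp0 hd
  have hpd' := one_sub_mul_mul_pow_ne_zero hp0 (inv_ne_zpow hd)
  have hd1 : d ≠ 1 := by simpa using hd 0
  have h1 : minimalSolution p d z 1 = 0 := by
    simpa [casoratian, h0, hu0] using hu.casoratian_minimalSolution hp0 hp hz hd0 hpd hpd' hlim
  have htheta : qTheta p z = 0 := by
    have hcas := casoratian_lommelSolution_minimalSolution hp0 hp hd0 hpd hpd' z
    rw [casoratian, h0, h1, mul_zero, mul_zero, sub_zero] at hcas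
    exact (mul_eq_zero.1 hcas.symm).resolve_left (sub_ne_zero.2 (inv_ne_one.2 hd1))
  have htheta' := qTheta_inv_mul_ne_zero hp0 hp hz hd0 hd htheta
  have hf : ∀ n, minimalSolution p d z n = 0 → lommelSolution p d z n = 0 := fun n hn => by
    simpa [minimalSolution, htheta, htheta', qPochInf_ne_zero hp hpd,
      qPochInf_ne_zero hp hpd'] using hn
  have hcas := casoratian_lommelSolution_dual hp0 hp hd0 hpd hpd' z
  rw [casoratian, hf 0 h0, hf 1 h1, zero_mul, zero_mul, sub_zero] at hcas
  exact hd1 (sub_eq_zero.1 hcas.symm).symm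

end LommelRecurrence

section LommelSystem

variable {p d α : ℝ} {P : ℕ → Polynomial ℝ} {μ : Measure ℝ} {z : ℂ}

/-- `P` has the Jacobi coefficients of the `q⁻¹`-Lommel polynomials, written with
`p = q²`, `d = q^{2ν}` and `α = q^{ν+1}`. -/
structure IsLommelSystem (p d α : ℝ) (P : ℕ → Polynomial ℝ) : Prop
    extends IsJacobiSystem (fun n => p ^ n * α) (fun n => -(p ^ n * (1 + d))) P where
  sq_eq : α ^ 2 = p * d

/-- The functions of the second kind of the polynomials `P n`, normalized so as to solve
`IsLommelSolution` when `IsLommelSystem p d α P`. -/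
noncomputable def lommelSecondKind (d α : ℝ) (P : ℕ → Polynomial ℝ) (μ : Measure ℝ) (z : ℂ) :
    ℕ → ℂ
  | 0 => 1
  | n + 1 => d * α ^ n * secondKind μ z (P n)

theorem tendsto_pow_mul_pow_choose_two {p : ℂ} (hp : ‖p‖ < 1) (c : ℂ) :
    Tendsto (fun n : ℕ => c ^ n * p ^ n.choose 2) atTop (𝓝 0) := by
  have hratio : Tendsto (fun n : ℕ => p ^ n * c) atTop (𝓝 0) := by
    simpa using (tendsto_pow_atTop_nhds_zero_of_norm_lt_one hp).mul_const c
  refine (summable_of_succ_eq_mul hratio fun n => ?_).tendsto_atTop_zero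
  rw [choose_two_succ, pow_add, pow_succ]
  ring

namespace IsLommelSystem

theorem base_ne_zero (hP : IsLommelSystem p d α P) : (p : ℂ) ≠ 0 :=
  Complex.ofReal_ne_zero.2 fun hp => hP.ne_zero 1 (by simp [hp])

theorem parameter_ne_zero (hP : IsLommelSystem p d α P) : (d : ℂ) ≠ 0 :=
  Complex.ofReal_ne_zero.2 fun hd => hP.ne_zero 0 (by simpa [hd] using hP.sq_eq)

theorem ne_zero_of_notMem_support (hP : IsLommelSystem p d α P) (hp : ‖(p : ℂ)‖ < 1)
    (h : IsOrthonormalMeasure P μ) (hz : z ∉ Complex.ofReal '' μ.support) : z ≠ 0 := by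
  rintro rfl
  have hpow : Tendsto (fun n : ℕ => p ^ n) atTop (𝓝 0) :=
    tendsto_pow_atTop_nhds_zero_of_norm_lt_one (by simpa using hp)
  refine hz ⟨0, hP.zero_mem_support h ?_ ?_, Complex.ofReal_zero⟩
  · simpa using hpow.mul_const α
  · simpa using (hpow.mul_const (1 + d)).neg

theorem isLommelSolution_lommelSecondKind (hP : IsLommelSystem p d α P)
    (h : IsOrthonormalMeasure P μ) (hz : z ∉ Complex.ofReal '' μ.support) :
    IsLommelSolution p d z (lommelSecondKind d α P μ z) := fun n => by
  have hp0 := hP.base_ne_zero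
  cases n with
  | zero =>
    have hrec := hP.secondKind_zero h hz
    push_cast at hrec
    simp only [lommelSecondKind]
    linear_combination (d : ℂ) * hrec
  | succ n =>
    have hrec := hP.secondKind_succ h hz n
    have hα : (α : ℂ) ^ 2 = p * d := by exact_mod_cast hP.sq_eq
    have hpow : (p : ℂ) ^ (n + 1) * (p : ℂ)⁻¹ ^ (n + 1) = 1 := by
      rw [← mul_pow, mul_inv_cancel₀ hp0, one_pow]
    push_cast at hrec
    refine mul_left_cancel₀ (pow_ne_zero (n + 1) hp0) ?_
    simp only [lommelSecondKind]
    linear_combination d * (α : ℂ) ^ (n + 1) * hrec -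
      d * (α : ℂ) ^ (n + 1) * z * secondKind μ z (P (n + 1)) * hpow -
      d * (p : ℂ) ^ n * (α : ℂ) ^ n * secondKind μ z (P n) * hα

theorem tendsto_lommelSecondKind (hP : IsLommelSystem p d α P) (hp : ‖(p : ℂ)‖ < 1)
    (h : IsOrthonormalMeasure P μ) (hz : z ∉ Complex.ofReal '' μ.support) :
    Tendsto (fun n : ℕ => z⁻¹ ^ n * (p : ℂ) ^ n.choose 2 * lommelSecondKind d α P μ z (n + 1))
      atTop (𝓝 0) := by
  have := h.isProbabilityMeasure hP.zero
  obtain ⟨C, hC⟩ := h.exists_norm_secondKind_le hz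
  have hdecay := (tendsto_pow_mul_pow_choose_two hp (z⁻¹ * α)).zero_mul_isBoundedUnder_le
    (isBoundedUnder_of ⟨C, hC⟩)
  simpa only [mul_zero] using (hdecay.const_mul (d : ℂ)).congr fun n => by
    rw [lommelSecondKind, mul_pow]
    ring

theorem minimalSolution_zero_ne_zero (hP : IsLommelSystem p d α P) (hp : ‖(p : ℂ)‖ < 1)
    (hd : ∀ m : ℤ, (d : ℂ) ≠ (p : ℂ) ^ m) (h : IsOrthonormalMeasure P μ)
    (hz : z ∉ Complex.ofReal '' μ.support) : minimalSolution p d z 0 ≠ 0 :=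
  (hP.isLommelSolution_lommelSecondKind h hz).minimalSolution_zero_ne_zero hP.base_ne_zero hp
    (hP.ne_zero_of_notMem_support hp h hz) hP.parameter_ne_zero hd
    (hP.tendsto_lommelSecondKind hp h hz) one_ne_zero

theorem secondKind_one_eq (hP : IsLommelSystem p d α P) (hp : ‖(p : ℂ)‖ < 1)
    (hd : ∀ m : ℤ, (d : ℂ) ≠ (p : ℂ) ^ m) (h : IsOrthonormalMeasure P μ)
    (hz : z ∉ Complex.ofReal '' μ.support) (hf : lommelSolution p d z 0 ≠ 0) :
    secondKind μ z 1 = 1 / (d * lommelSolution p d z 0) *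
      (lommelSolution p d z 1 - ((d : ℂ)⁻¹ - 1) * qTheta p z / minimalSolution p d z 0) := by
  have hp0 := hP.base_ne_zero
  have hd0 := hP.parameter_ne_zero
  have hpd := one_sub_mul_mul_pow_ne_zero hp0 hd
  have hpd' := one_sub_mul_mul_pow_ne_zero hp0 (inv_ne_zpow hd)
  have hm := hP.minimalSolution_zero_ne_zero hp hd h hz
  have hmin := (hP.isLommelSolution_lommelSecondKind h hz).casoratian_minimalSolution hp0 hp
    (hP.ne_zero_of_notMem_support hp h hz) hd0 hpd hpd' (hP.tendsto_lommelSecondKind hp h hz)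
  have hcas := casoratian_lommelSolution_minimalSolution hp0 hp hd0 hpd hpd' z
  rw [casoratian, lommelSecondKind, lommelSecondKind, hP.zero, pow_zero, mul_one, one_mul] at hmin
  rw [casoratian] at hcas
  rw [← hcas, one_div, eq_inv_mul_iff_mul_eq₀ (mul_ne_zero hd0 hf), eq_sub_iff_add_eq,
    ← eq_sub_iff_add_eq', div_eq_iff hm]
  linear_combination lommelSolution p d z 0 * hmin

end IsLommelSystem

end LommelSystem

section Identification

variable {q ν : ℝ}

theorem isLommelSystem_lommelP (hq : 0 < q) (ν : ℝ) :
    IsLommelSystem (q ^ 2) (q ^ (2 * ν)) (q ^ (ν + 1)) (lommelP q ν) := by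
  have ha : ∀ n, lommelA q ν n = (q ^ 2) ^ n * q ^ (ν + 1) := fun n => by
    rw [lommelA, add_assoc, Real.rpow_add hq, ← pow_mul, ← Real.rpow_natCast]
    push_cast
    rfl
  have hb : ∀ n, lommelB q ν n = -((q ^ 2) ^ n * (1 + q ^ (2 * ν))) := fun n => by
    rw [lommelB, pow_mul]
  have hC : ∀ n, Polynomial.C (lommelA q ν n) * Polynomial.C (lommelA q ν n)⁻¹ = 1 := fun n => by
    have hpos : 0 < lommelA q ν n := Real.rpow_pos_of_pos hq _
    rw [← Polynomial.C_mul, mul_inv_cancel₀ hpos.ne', Polynomial.C_1]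
  refine ⟨⟨fun n => by positivity, rfl, ?_, fun n => ?_⟩, ?_⟩
  · simp only [← ha, ← hb, lommelP, Polynomial.smul_eq_C_mul]
    linear_combination -(Polynomial.X - Polynomial.C (lommelB q ν 0)) * hC 0
  · simp only [← ha, ← hb, lommelP.eq_3, Polynomial.smul_eq_C_mul]
    linear_combination -((Polynomial.X - Polynomial.C (lommelB q ν (n + 1))) * lommelP q ν (n + 1)
      - Polynomial.C (lommelA q ν n) * lommelP q ν n) * hC (n + 1)
  · rw [← Real.rpow_natCast, ← Real.rpow_natCast, ← Real.rpow_mul hq.le, ← Real.rpow_add hq]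
    push_cast
    ring_nf

theorem isLommelOrthogonalityMeasure_iff {μ : Measure ℝ} :
    IsLommelOrthogonalityMeasure q ν μ ↔ IsOrthonormalMeasure (lommelP q ν) μ :=
  ⟨fun h => ⟨h.integrable, h.orthonormal⟩, fun h => ⟨h.integrable, h.orthonormal⟩⟩

theorem existsUnique_isLommelOrthogonalityMeasure (hq0 : 0 < q) (hq1 : q < 1) (ν : ℝ) :
    ∃! μ : Measure ℝ, IsLommelOrthogonalityMeasure q ν μ := by
  have hgeom : Summable fun n : ℕ => (q ^ 2) ^ n :=
    summable_geometric_of_lt_one (sq_nonneg q) (pow_lt_one₀ hq0.le hq1 two_ne_zero)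
  simpa only [isLommelOrthogonalityMeasure_iff] using
    (isLommelSystem_lommelP hq0 ν).existsUnique_isOrthonormalMeasure
      (hgeom.mul_right _).abs (hgeom.mul_right _).neg.abs

theorem qBesselI_eq_qBesselSeries (ν p : ℝ) (x : ℂ) :
    qBesselI ν p x = qBesselSeries p ((p ^ (ν + 1) : ℝ) : ℂ) (x ^ 2) := by
  refine tsum_congr fun n => ?_
  have hchoose : (n + 1).choose 2 = n * (n + 1) / 2 := by
    rw [Nat.choose_two_right, Nat.add_sub_cancel, mul_comm]
  have hsign : (-1 : ℂ) ^ n * (Complex.I * x) ^ (2 * n) = (x ^ 2) ^ n := by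
    rw [pow_mul, ← mul_pow, mul_pow Complex.I, Complex.I_sq]
    ring
  rw [qBesselCoeff, hchoose, ← hsign]
  ring

theorem qBesselI_sq_eq_qBesselSeries (hq : 0 < q) (ν : ℝ) (x : ℂ) :
    qBesselI ν (q ^ 2) x =
      qBesselSeries (q ^ 2 : ℝ) ((q ^ 2 : ℝ) * (q ^ (2 * ν) : ℝ)) (x ^ 2) := by
  rw [qBesselI_eq_qBesselSeries, Real.rpow_add_one (pow_ne_zero 2 hq.ne'), ← Real.rpow_natCast q 2,
    ← Real.rpow_mul hq.le, Nat.cast_ofNat, Complex.ofReal_mul, mul_comm]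

theorem qBesselI_q_mul_eq_lommelSolution_zero (hq : 0 < q) (ν : ℝ) (s : ℂ) :
    qBesselI ν (q ^ 2) (q * s) = lommelSolution (q ^ 2 : ℝ) (q ^ (2 * ν) : ℝ) (s ^ 2) 0 := by
  rw [qBesselI_sq_eq_qBesselSeries hq, lommelSolution_zero, mul_pow, ← Complex.ofReal_pow]

theorem qBesselI_eq_lommelSolution_one (hq : 0 < q) (ν : ℝ) (s : ℂ) :
    qBesselI ν (q ^ 2) s = lommelSolution (q ^ 2 : ℝ) (q ^ (2 * ν) : ℝ) (s ^ 2) 1 := by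
  rw [qBesselI_sq_eq_qBesselSeries hq,
    lommelSolution_one (Complex.ofReal_ne_zero.2 (pow_ne_zero 2 hq.ne'))]

theorem qBesselI_neg_eq_dualLommelSolution_zero (hq : 0 < q) (ν : ℝ) (s : ℂ) :
    qBesselI (-ν) (q ^ 2) ((q ^ (1 - ν) : ℝ) * s) =
      dualLommelSolution (q ^ 2 : ℝ) (q ^ (2 * ν) : ℝ) (s ^ 2) 0 := by
  have hparam : q ^ (2 * -ν) = (q ^ (2 * ν))⁻¹ := by
    rw [mul_neg, Real.rpow_neg hq.le]
  have harg : (q ^ (1 - ν)) ^ 2 = q ^ 2 * (q ^ (2 * ν))⁻¹ := by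
    rw [← Real.rpow_neg hq.le, ← Real.rpow_natCast, ← Real.rpow_natCast, ← Real.rpow_mul hq.le,
      ← Real.rpow_add hq]
    push_cast
    ring_nf
  rw [qBesselI_sq_eq_qBesselSeries hq, dualLommelSolution, lommelSolution_zero, pow_zero, one_mul,
    mul_pow, ← Complex.ofReal_pow (q ^ (1 - ν)), harg, hparam, Complex.ofReal_mul,
    Complex.ofReal_inv, mul_assoc ((q ^ 2 : ℝ) : ℂ)]

theorem lommelTheta_eq_qTheta (q : ℝ) (z : ℂ) : lommelTheta q z = qTheta (q ^ 2 : ℝ) z := by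
  rw [lommelTheta, qTheta, Complex.ofReal_pow]

theorem lommelDenom_eq_minimalSolution_zero (hq : 0 < q) (ν : ℝ) (s : ℂ) :
    lommelDenom q ν (s ^ 2) s =
      minimalSolution (q ^ 2 : ℝ) (q ^ (2 * ν) : ℝ) (s ^ 2) 0 := by
  have hinv : q ^ (-2 * ν) = (q ^ (2 * ν))⁻¹ := by
    rw [neg_mul, Real.rpow_neg hq.le]
  have hmul : q ^ (2 * ν + 2) = q ^ 2 * q ^ (2 * ν) := by
    rw [Real.rpow_add hq, Real.rpow_two, mul_comm]
  have hmul_inv : q ^ (-2 * ν + 2) = q ^ 2 * (q ^ (2 * ν))⁻¹ := by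
    rw [Real.rpow_add hq, hinv, Real.rpow_two, mul_comm]
  have hsub : q ^ (2 - 2 * ν) = q ^ 2 * (q ^ (2 * ν))⁻¹ := by
    rw [← hmul_inv, neg_mul, sub_eq_neg_add]
  rw [lommelDenom, minimalSolution, qBesselI_neg_eq_dualLommelSolution_zero hq,
    qBesselI_q_mul_eq_lommelSolution_zero hq, lommelTheta_eq_qTheta, lommelSigma, hsub,
    hmul, hmul_inv, hinv, ← Complex.ofReal_pow, Complex.ofReal_mul, Complex.ofReal_mul,
    Complex.ofReal_inv, qTheta, qTheta, mul_inv, inv_inv]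
  ring_nf

theorem lommelStieltjes_eq (hq : 0 < q) (ν : ℝ) (s : ℂ) :
    lommelStieltjes q ν (s ^ 2) s =
      1 / ((q ^ (2 * ν) : ℝ) * lommelSolution (q ^ 2 : ℝ) (q ^ (2 * ν) : ℝ) (s ^ 2) 0) *
        (lommelSolution (q ^ 2 : ℝ) (q ^ (2 * ν) : ℝ) (s ^ 2) 1 -
          (((q ^ (2 * ν) : ℝ) : ℂ)⁻¹ - 1) * qTheta (q ^ 2 : ℝ) (s ^ 2) /
            minimalSolution (q ^ 2 : ℝ) (q ^ (2 * ν) : ℝ) (s ^ 2) 0) := by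
  rw [lommelStieltjes, qBesselI_q_mul_eq_lommelSolution_zero hq, qBesselI_eq_lommelSolution_one hq,
    lommelTheta_eq_qTheta, lommelDenom_eq_minimalSolution_zero hq, neg_mul, Real.rpow_neg hq.le,
    Complex.ofReal_inv]

theorem norm_ofReal_sq_lt_one (hq0 : 0 < q) (hq1 : q < 1) : ‖((q ^ 2 : ℝ) : ℂ)‖ < 1 := by
  rw [Complex.norm_of_nonneg (sq_nonneg q)]
  exact pow_lt_one₀ hq0.le hq1 two_ne_zero

theorem ofReal_rpow_two_mul_ne_zpow (hq0 : 0 < q) (hq1 : q < 1) (hν : ∀ n : ℤ, ν ≠ n) (m : ℤ) :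
    ((q ^ (2 * ν) : ℝ) : ℂ) ≠ ((q ^ 2 : ℝ) : ℂ) ^ m := by
  rw [← Complex.ofReal_zpow, Complex.ofReal_injective.ne_iff, ← Real.rpow_two, ← Real.rpow_intCast,
    ← Real.rpow_mul hq0.le, (Real.strictAnti_rpow_of_base_lt_one hq0 hq1).injective.ne_iff,
    (mul_right_injective₀ two_ne_zero).ne_iff]
  exact hν m

theorem eventually_qBesselI_ne_zero (hq0 : 0 < q) (hq1 : q < 1) (ν : ℝ) (s : ℂ) :
    ∀ᶠ w in 𝓝[≠] s, qBesselI ν (q ^ 2) ((q : ℂ) * w) ≠ 0 := by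
  have hdiff : Differentiable ℂ fun w : ℂ => qBesselI ν (q ^ 2) ((q : ℂ) * w) := by
    have hF := differentiable_qBesselSeries (norm_ofReal_sq_lt_one hq0 hq1)
    simp only [qBesselI_eq_qBesselSeries]
    fun_prop
  have hanalytic : AnalyticOnNhd ℂ (fun w : ℂ => qBesselI ν (q ^ 2) ((q : ℂ) * w)) Set.univ :=
    fun w _ => hdiff.analyticAt w
  by_contra hfreq
  have hzero : qBesselI ν (q ^ 2) ((q : ℂ) * 0) = 0 :=
    hanalytic.eqOn_zero_of_preconnected_of_frequently_eq_zero isPreconnected_univ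
      (Set.mem_univ s) hfreq (Set.mem_univ 0)
  rw [mul_zero, qBesselI_eq_qBesselSeries, zero_pow two_ne_zero, qBesselSeries_zero] at hzero
  exact one_ne_zero hzero

namespace IsLommelOrthogonalityMeasure

variable {μ : Measure ℝ} {s : ℂ}

theorem lommelDenom_ne_zero (h : IsLommelOrthogonalityMeasure q ν μ) (hq0 : 0 < q) (hq1 : q < 1)
    (hν : ∀ n : ℤ, ν ≠ n) (hs : s ^ 2 ∉ Complex.ofReal '' μ.support) :
    lommelDenom q ν (s ^ 2) s ≠ 0 := by
  rw [lommelDenom_eq_minimalSolution_zero hq0]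
  exact (isLommelSystem_lommelP hq0 ν).minimalSolution_zero_ne_zero
    (norm_ofReal_sq_lt_one hq0 hq1) (ofReal_rpow_two_mul_ne_zpow hq0 hq1 hν)
    (isLommelOrthogonalityMeasure_iff.1 h) hs

theorem secondKind_one_eq_lommelStieltjes (h : IsLommelOrthogonalityMeasure q ν μ) (hq0 : 0 < q)
    (hq1 : q < 1) (hν : ∀ n : ℤ, ν ≠ n) (hs : s ^ 2 ∉ Complex.ofReal '' μ.support)
    (hI : qBesselI ν (q ^ 2) (q * s) ≠ 0) :
    secondKind μ (s ^ 2) 1 = lommelStieltjes q ν (s ^ 2) s := by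
  rw [lommelStieltjes_eq hq0]
  rw [qBesselI_q_mul_eq_lommelSolution_zero hq0] at hI
  exact (isLommelSystem_lommelP hq0 ν).secondKind_one_eq
    (norm_ofReal_sq_lt_one hq0 hq1) (ofReal_rpow_two_mul_ne_zpow hq0 hq1 hν)
    (isLommelOrthogonalityMeasure_iff.1 h) hs hI

theorem tendsto_lommelStieltjes (h : IsLommelOrthogonalityMeasure q ν μ) (hq0 : 0 < q)
    (hq1 : q < 1) (hν : ∀ n : ℤ, ν ≠ n) (hs : s ^ 2 ∉ Complex.ofReal '' μ.support) :
    Tendsto (fun w => lommelStieltjes q ν (w ^ 2) w) (𝓝[≠] s) (𝓝 (secondKind μ (s ^ 2) 1)) := by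
  have := (isLommelOrthogonalityMeasure_iff.1 h).isProbabilityMeasure rfl
  have hsq : Tendsto (fun w : ℂ => w ^ 2) (𝓝[≠] s) (𝓝 (s ^ 2)) :=
    ((continuous_pow 2).tendsto s).mono_left nhdsWithin_le_nhds
  refine ((continuousAt_secondKind_one hs).tendsto.comp hsq).congr' ?_
  filter_upwards [eventually_qBesselI_ne_zero hq0 hq1 ν s,
    hsq ((isClosed_ofReal_image_support μ).isOpen_compl.mem_nhds hs)] with w hw hws
  exact h.secondKind_one_eq_lommelStieltjes hq0 hq1 hν hws hw

end IsLommelOrthogonalityMeasure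

end Identification

theorem ne_intCast_of_neg_one_lt {x : ℝ} (hx : -1 < x) (hxN : ∀ n : ℕ, x ≠ n) (n : ℤ) :
    x ≠ n := fun hn => by
  have hn1 : -1 < n := by exact_mod_cast hn ▸ hx
  lift n to ℕ using by lia
  exact hxN n hn

theorem mainTheorem1_general (q ν : ℝ) (hq0 : 0 < q) (hq1 : q < 1) (hν : ∀ n : ℤ, ν ≠ n) :
    (∃! μ : Measure ℝ, IsLommelOrthogonalityMeasure q ν μ) ∧
    ∀ μ : Measure ℝ, IsLommelOrthogonalityMeasure q ν μ →
      ∀ z : ℂ, z ∉ (fun t : ℝ => (t : ℂ)) '' μ.support →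
        Integrable (fun t : ℝ => 1 / (z - (t : ℂ))) μ ∧
        ∀ s : ℂ, s ^ 2 = z →
          lommelDenom q ν z s ≠ 0 ∧
          (qBesselI ν (q ^ 2) ((q : ℂ) * s) ≠ 0 →
            ∫ t : ℝ, 1 / (z - (t : ℂ)) ∂μ = lommelStieltjes q ν z s) ∧
          Tendsto (fun w : ℂ => lommelStieltjes q ν (w ^ 2) w) (𝓝[≠] s)
            (𝓝 (∫ t : ℝ, 1 / (z - (t : ℂ)) ∂μ)) := by
  refine ⟨existsUnique_isLommelOrthogonalityMeasure hq0 hq1 ν, fun μ hμ z hz => ⟨?_, ?_⟩⟩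
  · have := (isLommelOrthogonalityMeasure_iff.1 hμ).isProbabilityMeasure rfl
    simpa using integrable_ofReal_div_sub hz (integrable_const 1)
  · rintro s rfl
    have hint : ∫ t : ℝ, 1 / (s ^ 2 - (t : ℂ)) ∂μ = secondKind μ (s ^ 2) 1 := by
      simp [secondKind]
    rw [hint]
    exact ⟨hμ.lommelDenom_ne_zero hq0 hq1 hν hz,
      hμ.secondKind_one_eq_lommelStieltjes hq0 hq1 hν hz,
      hμ.tendsto_lommelStieltjes hq0 hq1 hν hz⟩

theorem mainTheorem1 (q ν : ℝ) (hq0 : 0 < q) (hq1 : q < 1) (hν : -1 < ν)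
    (hνN : ∀ n : ℕ, ν ≠ (n : ℝ)) :
    (∃! μ : Measure ℝ, IsLommelOrthogonalityMeasure q ν μ) ∧
    ∀ μ : Measure ℝ, IsLommelOrthogonalityMeasure q ν μ →
      ∀ z : ℂ, z ∉ (fun t : ℝ => (t : ℂ)) '' μ.support →
        Integrable (fun t : ℝ => 1 / (z - (t : ℂ))) μ ∧
        ∀ s : ℂ, s ^ 2 = z →
          lommelDenom q ν z s ≠ 0 ∧
          (qBesselI ν (q ^ 2) ((q : ℂ) * s) ≠ 0 →
            ∫ t : ℝ, 1 / (z - (t : ℂ)) ∂μ = lommelStieltjes q ν z s) ∧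
          Tendsto (fun w : ℂ => lommelStieltjes q ν (w ^ 2) w) (𝓝[≠] s)
            (𝓝 (∫ t : ℝ, 1 / (z - (t : ℂ)) ∂μ)) := by
  exact mainTheorem1_general q ν hq0 hq1 (ne_intCast_of_neg_one_lt hν hνN)
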